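/- Let $f:\mathbb R\to\mathbb R$ be strictly convex and differentiable with $f'(0)\ge 0$, and assume that its convex conjugate $g(z)=\sup_{\rho\in\mathbb R}(z\rho-f(\rho))$ is finite for every $z\in\mathbb R$. Let $u_0:\mathbb R\to\mathbb R$ be nondecreasing and left-continuous (for instance nondecreasing and locally Lipschitz), and suppose that for all $x\in\mathbb R$, $t>0$ one has $u_0(y)+t\,g\left(\frac{x-y}{t}\right)\to\infty$ as $y\to-\infty$ (for $f(\rho)=\rho^2$, $g(z)=z^2/4$ this says exactly that $|y|^{-2}u_0(y)\to 0$ as $y\to-\infty$). For $x\in\mathbb R$ and $t>0$ let $$u(x,t)=\inf_{y\le x}\left\{u_0(y)+t\,g\left(\tfrac{x-y}{t}\right)\right\},\qquad I(x,t)=\left\{y\le x:\ u(x,t)=u_0(y)+t\,g\left(\tfrac{x-y}{t}\right)\right\},$$ $$y^-(x,t)=\inf I(x,t),\qquad y^+(x,t)=\sup I(x,t),\qquad \rho^\pm(x,t)=g'\left(\frac{x-y^\pm(x,t)}{t}\right).$$ For $\lambda\neq\rho$ let $\Theta(\lambda,\rho)\in[0,1]$ be defined by $$\frac{f(\lambda)-f(\rho)}{\lambda-\rho}=\Theta(\lambda,\rho)f'(\rho)+(1-\Theta(\lambda,\rho))f'(\lambda).$$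 Let $v_0:\mathbb R\to\mathbb R$ be an arbitrary continuous function, and for $x\in\mathbb R$, $t>0$ put $$v(x,t)=\theta(x,t)\,v_0(y^+(x,t))+(1-\theta(x,t))\,v_0(y^-(x,t)),\qquad \theta(x,t)=\Theta(\rho^+(x,t),\rho^-(x,t))$$ (where $y^-(x,t)=y^+(x,t)$ the weight is irrelevant and $v(x,t)=v_0(y^\pm(x,t))$). Then $v$ is a weak solution of $v_t+f'(\rho(x,t))v_x=0$, $v(\cdot,0)=v_0$, in the following Lebesgue–Stieltjes sense. For every $\phi\in C_c^\infty(\mathbb R\times[0,\infty))$ (restrictions of functions in $C_c^\infty(\mathbb R^2)$): for every $t>0$ there is a finite signed measure $\mu_t$ with $\mu_t(a,b]=\phi(b,t)f'(\rho^+(b,t))-\phi(a,t)f'(\rho^+(a,t))$ for all $a\le b$, and $v(\cdot,t)$ is $|\mu_t|$-integrable; $\phi_t v$ is integrable on $\mathbb R\times(0,\infty)$; $t\mapsto\int v(x,t)\,d\mu_t(x)$ is integrable on $(\varepsilon,\infty)$ for every $\varepsilon>0$; and $$\int_0^\infty\!\!\int_{\mathbb R}\phi_t(x,t)\,v(x,t)\,dx\,dt+\lim_{\varepsilon\downarrow0}\int_\varepsilon^\infty\!dt\int_{\mathbb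 R}v(x,t)\,d\mu_t(x)+\int_{\mathbb R}v_0(x)\,\phi(x,0)\,dx=0 .$$ (Whenever $t\mapsto\int v(x,t)\,d\mu_t(x)$ is integrable on $(0,\infty)$, the limit is the ordinary integral over $(0,\infty)$.) -/

import Mathlib

open Set Filter Topology MeasureTheory
open scoped ContDiff

noncomputable section

/-- The convex conjugate `g(z) = sup_ρ (z ρ - f ρ)` of a function on the real line
(meaningful when all these suprema are finite). -/
def convexConjugate (f : ℝ → ℝ) (z : ℝ) : ℝ :=
  sSup (range fun ρ : ℝ => z * ρ - f ρ)

/-- The function `y ↦ u₀(y) + t g((x - y) / t)` minimized in the Hopf-Lax formula,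
where `g` is the convex conjugate of `f`. -/
def hopfLaxObjective (f u₀ : ℝ → ℝ) (x t y : ℝ) : ℝ :=
  u₀ y + t * convexConjugate f ((x - y) / t)

/-- The Hopf-Lax function `u(x,t)`, an infimum over `y ≤ x`. -/
def hopfLax (f u₀ : ℝ → ℝ) (x t : ℝ) : ℝ :=
  sInf (hopfLaxObjective f u₀ x t '' Iic x)

/-- The set `I(x,t)` of Hopf-Lax minimizers. -/
def hopfLaxMinimizers (f u₀ : ℝ → ℝ) (x t : ℝ) : Set ℝ :=
  {y | y ≤ x ∧ hopfLax f u₀ x t = hopfLaxObjective f u₀ x t y}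

/-- The minimal Hopf-Lax minimizer `y⁻(x,t)`. -/
def yMinus (f u₀ : ℝ → ℝ) (x t : ℝ) : ℝ := sInf (hopfLaxMinimizers f u₀ x t)

/-- The maximal Hopf-Lax minimizer `y⁺(x,t)`. -/
def yPlus (f u₀ : ℝ → ℝ) (x t : ℝ) : ℝ := sSup (hopfLaxMinimizers f u₀ x t)

/-- The Lax-Oleinik density `ρ⁻(x,t) = g'((x - y⁻(x,t)) / t)`. -/
def rhoMinus (f u₀ : ℝ → ℝ) (x t : ℝ) : ℝ :=
  deriv (convexConjugate f) ((x - yMinus f u₀ x t) / t)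

/-- The Lax-Oleinik density `ρ⁺(x,t) = g'((x - y⁺(x,t)) / t)`. -/
def rhoPlus (f u₀ : ℝ → ℝ) (x t : ℝ) : ℝ :=
  deriv (convexConjugate f) ((x - yPlus f u₀ x t) / t)

/-- The weight `Θ(l, r)` determined for `l ≠ r` by
`(f l - f r) / (l - r) = Θ f'(r) + (1 - Θ) f'(l)`; see `shockWeight_spec` and
`shockWeight_unique`. -/
def shockWeight (f : ℝ → ℝ) (l r : ℝ) : ℝ :=
  ((f l - f r) / (l - r) - deriv f l) / (deriv f r - deriv f l)

theorem shockWeight_spec (f : ℝ → ℝ) (l r : ℝ) (h : deriv f l ≠ deriv f r) :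
    (f l - f r) / (l - r) =
      shockWeight f l r * deriv f r + (1 - shockWeight f l r) * deriv f l := by
  have h' : deriv f r - deriv f l ≠ 0 := sub_ne_zero.mpr (Ne.symm h)
  have := div_mul_cancel₀ ((f l - f r) / (l - r) - deriv f l) h'
  unfold shockWeight
  linear_combination -this

theorem shockWeight_unique (f : ℝ → ℝ) (l r c : ℝ) (h : deriv f l ≠ deriv f r)
    (hc : (f l - f r) / (l - r) = c * deriv f r + (1 - c) * deriv f l) :
    c = shockWeight f l r := by
  have h' : deriv f r - deriv f l ≠ 0 := sub_ne_zero.mpr (Ne.symm h)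
  unfold shockWeight
  rw [eq_div_iff h', hc]
  ring

/-- The function `v = θ v₀(y⁺) + (1 - θ) v₀(y⁻)` with `θ = Θ(ρ⁺, ρ⁻)`, for `t > 0`.
Where `y⁻ = y⁺` the value is `v₀(y⁺)` and the weight plays no role. -/
def transportedData (f u₀ v₀ : ℝ → ℝ) (x t : ℝ) : ℝ :=
  shockWeight f (rhoPlus f u₀ x t) (rhoMinus f u₀ x t) * v₀ (yPlus f u₀ x t) +
    (1 - shockWeight f (rhoPlus f u₀ x t) (rhoMinus f u₀ x t)) * v₀ (yMinus f u₀ x t)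

/-- `μ` is the Lebesgue-Stieltjes signed measure `dF`: `μ (a, b] = F b - F a` for `a ≤ b`.
(There is at most one such `μ`; if there is one, `F` is right-continuous and of bounded
variation.) -/
def IsStieltjesMeasure (F : ℝ → ℝ) (μ : SignedMeasure ℝ) : Prop :=
  ∀ a b : ℝ, a ≤ b → μ (Ioc a b) = F b - F a

/-- The time derivative `φ_t` of a function of `(x, t)`. -/
def timeDeriv (φ : ℝ × ℝ → ℝ) (x t : ℝ) : ℝ := deriv (fun s => φ (x, s)) t

/-- `v` (a function on `ℝ × (0,∞)`) is a weak solution of `v_t + c v_x = 0`, `v(·,0) = v₀`,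
in the Lebesgue-Stieltjes integral sense: for every test function `φ` on `ℝ × [0,∞)`
(the restriction of a smooth compactly supported function on the plane),
`∫₀^∞ ∫ φ_t v dx dt + ∫₀^∞ dt ∫ v(x,t) d[φ(·,t) c(·,t)](x) + ∫ v₀(x) φ(x,0) dx = 0`.
The measures `d[φ(·,t) c(·,t)]` and all integrals are required to exist; the time integral in
the second term is improper at `t = 0`, i.e. it is `lim_{ε ↓ 0} ∫_ε^∞`, and so agrees with the
Lebesgue integral whenever the latter converges. -/
def IsWeakTransportSolution (c : ℝ → ℝ → ℝ) (v₀ : ℝ → ℝ) (v : ℝ → ℝ → ℝ) : Prop :=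
  ∀ φ : ℝ × ℝ → ℝ, ContDiff ℝ ∞ φ → HasCompactSupport φ →
    ∃ μ : ℝ → SignedMeasure ℝ,
      (∀ t, 0 < t → IsStieltjesMeasure (fun x => φ (x, t) * c x t) (μ t)) ∧
      (∀ t, 0 < t → (μ t).Integrable (fun x => v x t)) ∧
      IntegrableOn (fun p : ℝ × ℝ => timeDeriv φ p.1 p.2 * v p.1 p.2) (univ ×ˢ Ioi 0) ∧
      (∀ ε, 0 < ε → IntegrableOn (fun t => ∫ᵛ x, v x t ∂•(μ t)) (Ioi ε)) ∧
      Tendsto (fun ε : ℝ =>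
          (∫ t in Ioi (0 : ℝ), ∫ x, timeDeriv φ x t * v x t) +
          (∫ t in Ioi ε, ∫ᵛ x, v x t ∂•(μ t)) +
          ∫ x, v₀ x * φ (x, 0))
        (𝓝[>] 0) (𝓝 0)

end

/-! The equation is linear in `v`, so it suffices to treat steps and then approximate. For `v₀ =
1_{y > a}`, up to values on the front, the transported data are the indicator of the region to the
right of the front `X(t) = hopfLaxFront f u₀ a t`; `frontStep` puts the weight `θ` on the front
itself. The measure `d[φ f'(ρ⁺)]` may have an atom at `X(t)`, and with the weight `θ` there the
integral of the step is `-φ(X, t)` times `meanSpeed`, that is `θ f'(ρ⁻) + (1 - θ) f'(ρ⁺)`. At a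
shock the definition of `Θ` turns this into the Rankine-Hugoniot speed `(f(ρ⁻) - f(ρ⁺)) / (ρ⁻ -
ρ⁺)`, which is the velocity of `X` (`hasDerivWithinAt_front`). The `φ_t` term and the flux term
therefore add up to `d/dt ∫_{X(t)}^∞ φ dx`, and integration over `(ε, ∞)` gives the weak equation
with initial time `ε` (`solvesFrom_frontStep`).

The velocity of a front comes from the variational formula. Minimizers are closed under limits,
ordered in `x`, and unique in the interior of a characteristic. Hence along a front `y⁻` decreases
and `y⁺` increases in time, so both converge as `s ↓ t`. Minimality at the two times, read through
`t g(w/t) = sup_ρ (w ρ - t f(ρ))`, squeezes the difference quotient of `X` (`linearized_le`). This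
yields a right derivative, which is enough for the fundamental theorem of calculus.

For continuous `v₀`, the minimizers over the support of `φ` stay in a compact interval, on which
`v₀` is uniformly close to a staircase. The weight `θ(x, t)` does not depend on the level `a`, so
`v` is uniformly close to a combination of front steps (`exists_staircase_approximation`). The
variation of `μ_t` is controlled only by a multiple of `1/t`, so this limit is taken at fixed `ε`
(`transport_identity`). As `ε ↓ 0` the minimizers tend to `x`, the `φ_t` term and the term at time
`ε` converge, and the flux term must then converge too. -/

/-! ### Convex conjugates of differentiable strictly convex functions -/

/-- A differentiable strictly convex function on the line with finite convex conjugate. -/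
structure LegendreFunction (f : ℝ → ℝ) : Prop where
  convex : StrictConvexOn ℝ univ f
  diff : Differentiable ℝ f
  conj : ∀ z : ℝ, BddAbove (range fun ρ : ℝ => z * ρ - f ρ)

namespace LegendreFunction

variable {f : ℝ → ℝ}

theorem le_conjugate (h : LegendreFunction f) (z ρ : ℝ) :
    z * ρ - f ρ ≤ convexConjugate f z :=
  le_csSup (h.conj z) ⟨ρ, rfl⟩

theorem strictMono_deriv (h : LegendreFunction f) : StrictMono (deriv f) :=
  strictMonoOn_univ.mp (h.convex.strictMonoOn_deriv fun x _ => h.diff x)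

/-- Finiteness of the conjugate at `z + 1` and `z - 1` bounds `f σ - z σ` below by `|σ|` minus a
constant, so this function is coercive. -/
theorem exists_maximizer (h : LegendreFunction f) (z : ℝ) :
    ∃ ρ, ∀ σ, z * σ - f σ ≤ z * ρ - f ρ := by
  have hc : Continuous fun σ => f σ - z * σ :=
    h.diff.continuous.sub (continuous_const.mul continuous_id)
  have hlim : Tendsto (fun σ => f σ - z * σ) (cocompact ℝ) atTop := by
    have h1 : ∀ σ, |σ| + -max (convexConjugate f (z + 1)) (convexConjugate f (z - 1)) ≤
        f σ - z * σ := by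
      intro σ
      have e1 := h.le_conjugate (z + 1) σ
      have e2 := h.le_conjugate (z - 1) σ
      have m1 := le_max_left (convexConjugate f (z + 1)) (convexConjugate f (z - 1))
      have m2 := le_max_right (convexConjugate f (z + 1)) (convexConjugate f (z - 1))
      rcases abs_cases σ with ⟨e, _⟩ | ⟨e, _⟩ <;> rw [e] <;> linarith
    refine tendsto_atTop_mono h1 (tendsto_atTop_add_const_right _ _ ?_)
    exact tendsto_norm_cocompact_atTop (E := ℝ)
  obtain ⟨ρ, hρ⟩ := hc.exists_forall_le hlim
  exact ⟨ρ, fun σ => by have := hρ σ; linarith⟩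

theorem deriv_eq_of_maximizer (h : LegendreFunction f) {z ρ : ℝ}
    (hρ : ∀ σ, z * σ - f σ ≤ z * ρ - f ρ) : deriv f ρ = z := by
  have hmax : IsLocalMax (fun σ => z * σ - f σ) ρ := Eventually.of_forall hρ
  have hd : HasDerivAt (fun σ => z * σ - f σ) (z * 1 - deriv f ρ) ρ :=
    ((hasDerivAt_id ρ).const_mul z).sub (h.diff ρ).hasDerivAt
  have := hmax.hasDerivAt_eq_zero hd
  linarith

theorem surjective_deriv (h : LegendreFunction f) : Function.Surjective (deriv f) := fun z =>
  let ⟨ρ, hρ⟩ := h.exists_maximizer z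
  ⟨ρ, h.deriv_eq_of_maximizer hρ⟩

/-- The derivative of `f` as an order isomorphism of the line. -/
noncomputable def derivIso (h : LegendreFunction f) : ℝ ≃o ℝ :=
  StrictMono.orderIsoOfSurjective (deriv f) h.strictMono_deriv h.surjective_deriv

theorem derivIso_apply (h : LegendreFunction f) (ρ : ℝ) : h.derivIso ρ = deriv f ρ := rfl

theorem conjugate_eq_derivIso_symm (h : LegendreFunction f) (z : ℝ) :
    convexConjugate f z = z * h.derivIso.symm z - f (h.derivIso.symm z) := by
  obtain ⟨ρ, hρ⟩ := h.exists_maximizer z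
  have e : h.derivIso.symm z = ρ := by
    rw [OrderIso.symm_apply_eq, derivIso_apply, h.deriv_eq_of_maximizer hρ]
  rw [e]
  refine le_antisymm (csSup_le (range_nonempty _) ?_) (h.le_conjugate z ρ)
  rintro _ ⟨σ, rfl⟩
  exact hρ σ

/-- The subgradient inequality at `z` and at `w` traps the difference quotient between `(f')⁻¹(z)`
and `(f')⁻¹(w)`. The inverse is continuous, being an order isomorphism of the line. -/
theorem hasDerivAt_conjugate (h : LegendreFunction f) (z : ℝ) :
    HasDerivAt (convexConjugate f) (h.derivIso.symm z) z := by
  have key : ∀ z w, (w - z) * h.derivIso.symm z ≤ convexConjugate f w - convexConjugate f z := by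
    intro z w
    have := h.le_conjugate w (h.derivIso.symm z)
    rw [h.conjugate_eq_derivIso_symm z]
    linarith
  have hc : Continuous h.derivIso.symm := h.derivIso.symm.continuous
  rw [hasDerivAt_iff_tendsto_slope, tendsto_iff_norm_sub_tendsto_zero]
  have hlim : Tendsto (fun w => ‖h.derivIso.symm w - h.derivIso.symm z‖) (𝓝[≠] z) (𝓝 0) := by
    rw [← tendsto_iff_norm_sub_tendsto_zero]
    exact hc.continuousAt.tendsto.mono_left nhdsWithin_le_nhds
  refine squeeze_zero' (Eventually.of_forall fun _ => norm_nonneg _) ?_ hlim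
  filter_upwards [self_mem_nhdsWithin] with w hw
  have k1 := key z w
  have k2 := key w z
  have hne : w - z ≠ 0 := sub_ne_zero.mpr hw
  rw [slope_def_field, Real.norm_eq_abs, Real.norm_eq_abs]
  rcases lt_or_gt_of_ne hw with hlt | hlt
  · have hneg : w - z < 0 := by simpa using hlt
    have a1 : (convexConjugate f w - convexConjugate f z) / (w - z) ≤ h.derivIso.symm z := by
      rw [div_le_iff_of_neg hneg]; linarith
    have a2 : h.derivIso.symm w ≤ (convexConjugate f w - convexConjugate f z) / (w - z) := by
      rw [le_div_iff_of_neg hneg]; linarith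
    rw [abs_of_nonpos (by linarith), abs_of_nonpos (by linarith)]
    linarith
  · have hpos : 0 < w - z := by simpa using hlt
    have a1 : h.derivIso.symm z ≤ (convexConjugate f w - convexConjugate f z) / (w - z) := by
      rw [le_div_iff₀ hpos]; linarith
    have a2 : (convexConjugate f w - convexConjugate f z) / (w - z) ≤ h.derivIso.symm w := by
      rw [div_le_iff₀ hpos]; linarith
    rw [abs_of_nonneg (by linarith), abs_of_nonneg (by linarith)]
    linarith

theorem deriv_conjugate (h : LegendreFunction f) :
    deriv (convexConjugate f) = h.derivIso.symm :=
  funext fun z => (h.hasDerivAt_conjugate z).deriv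

theorem differentiable_conjugate (h : LegendreFunction f) :
    Differentiable ℝ (convexConjugate f) :=
  fun z => (h.hasDerivAt_conjugate z).differentiableAt

theorem continuous_conjugate (h : LegendreFunction f) : Continuous (convexConjugate f) :=
  h.differentiable_conjugate.continuous

theorem strictMono_deriv_conjugate (h : LegendreFunction f) :
    StrictMono (deriv (convexConjugate f)) := by
  rw [h.deriv_conjugate]; exact h.derivIso.symm.strictMono

theorem continuous_deriv_conjugate (h : LegendreFunction f) :
    Continuous (deriv (convexConjugate f)) := by
  rw [h.deriv_conjugate]; exact h.derivIso.symm.continuous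

theorem tendsto_deriv_conjugate_atTop (h : LegendreFunction f) :
    Tendsto (deriv (convexConjugate f)) atTop atTop := by
  rw [h.deriv_conjugate]; exact h.derivIso.symm.tendsto_atTop

theorem deriv_deriv_conjugate (h : LegendreFunction f) (z : ℝ) :
    deriv f (deriv (convexConjugate f) z) = z := by
  rw [h.deriv_conjugate]
  exact h.derivIso.apply_symm_apply z

theorem conjugate_eq (h : LegendreFunction f) (z : ℝ) :
    convexConjugate f z =
      z * deriv (convexConjugate f) z - f (deriv (convexConjugate f) z) := by
  rw [h.deriv_conjugate]; exact h.conjugate_eq_derivIso_symm z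

theorem strictConvexOn_conjugate (h : LegendreFunction f) :
    StrictConvexOn ℝ univ (convexConjugate f) :=
  h.strictMono_deriv_conjugate.strictConvexOn_univ_of_deriv h.continuous_conjugate

/-- The form of strict convexity that keeps minimizers for different `x` from crossing. -/
theorem strictMono_conjugate_shift_sub (h : LegendreFunction f) {d : ℝ} (hd : 0 < d) :
    StrictMono fun s => convexConjugate f (s + d) - convexConjugate f s := by
  refine strictMono_of_deriv_pos fun s => ?_
  have h1 : HasDerivAt (fun s => convexConjugate f (s + d))
      (deriv (convexConjugate f) (s + d)) s :=
    (h.differentiable_conjugate (s + d)).hasDerivAt.comp_add_const s d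
  have h2 := h1.sub (h.differentiable_conjugate s).hasDerivAt
  rw [show (fun s => convexConjugate f (s + d) - convexConjugate f s) =
    (fun s => convexConjugate f (s + d)) - convexConjugate f from rfl, h2.deriv]
  exact sub_pos.mpr (h.strictMono_deriv_conjugate (by linarith))

/-- The perspective `t g(w / t)` of the conjugate is a supremum of affine functions of `(w, t)`. -/
theorem le_perspective (h : LegendreFunction f) {t : ℝ} (ht : 0 < t) (w ρ : ℝ) :
    w * ρ - t * f ρ ≤ t * convexConjugate f (w / t) := by
  have := mul_le_mul_of_nonneg_left (h.le_conjugate (w / t) ρ) ht.le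
  calc w * ρ - t * f ρ = t * (w / t * ρ - f ρ) := by field_simp
    _ ≤ _ := this

theorem perspective_eq (h : LegendreFunction f) {t : ℝ} (ht : 0 < t) (w : ℝ) :
    t * convexConjugate f (w / t) =
      w * deriv (convexConjugate f) (w / t) - t * f (deriv (convexConjugate f) (w / t)) := by
  rw [h.conjugate_eq (w / t)]
  field_simp

/-- Convexity of the conjugate on the segment from `0` to `w / t`, evaluated at the fraction `t /
T`. It transfers growth at one time to all earlier times. -/
theorem perspective_mono (h : LegendreFunction f) {t T : ℝ} (ht : 0 < t) (hT : t ≤ T) (w : ℝ) :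
    T * (convexConjugate f (w / T) - convexConjugate f 0) ≤
      t * (convexConjugate f (w / t) - convexConjugate f 0) := by
  have hT0 : 0 < T := ht.trans_le hT
  have hc := h.strictConvexOn_conjugate.convexOn.2 (mem_univ (w / t)) (mem_univ 0)
    (div_nonneg ht.le hT0.le) (sub_nonneg.mpr ((div_le_one hT0).mpr hT)) (by ring)
  have e : (t / T) • (w / t) + (1 - t / T) • (0 : ℝ) = w / T := by
    simp only [smul_eq_mul]; field_simp; ring
  rw [e] at hc
  simp only [smul_eq_mul] at hc
  have := mul_le_mul_of_nonneg_left hc hT0.le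
  have e2 : T * (t / T * convexConjugate f (w / t) + (1 - t / T) * convexConjugate f 0) =
      t * convexConjugate f (w / t) + (T - t) * convexConjugate f 0 := by
    field_simp
  rw [e2] at this
  linarith

/-- Strict convexity of the perspective along a subdivision of the time interval. -/
theorem perspective_lt (h : LegendreFunction f) {t t' w z : ℝ} (ht : 0 < t) (htt : t < t')
    (hne : w / t ≠ z) :
    t' * convexConjugate f ((w + (t' - t) * z) / t') <
      t * convexConjugate f (w / t) + (t' - t) * convexConjugate f z := by
  have ht' : 0 < t' := ht.trans htt
  have hc := h.strictConvexOn_conjugate.2 (mem_univ (w / t)) (mem_univ z) hne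
    (div_pos ht ht') (div_pos (sub_pos.mpr htt) ht') (by field_simp; ring)
  have e : (t / t') • (w / t) + ((t' - t) / t') • z = (w + (t' - t) * z) / t' := by
    simp only [smul_eq_mul]; field_simp
  rw [e] at hc
  simp only [smul_eq_mul] at hc
  have := mul_lt_mul_of_pos_left hc ht'
  calc _ < _ := this
    _ = _ := by field_simp

/-- The shock weight lies in `[0, 1]`. -/
theorem shockWeight_mem_Icc (h : LegendreFunction f) (l r : ℝ) :
    shockWeight f l r ∈ Icc (0 : ℝ) 1 := by
  unfold shockWeight
  rcases lt_trichotomy l r with hlr | rfl | hlr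
  · have h1 := h.convex.convexOn.deriv_le_slope (mem_univ l) (mem_univ r) hlr (h.diff l)
    have h2 := h.convex.convexOn.slope_le_deriv (mem_univ l) (mem_univ r) hlr (h.diff r)
    have h3 := h.strictMono_deriv hlr
    have e : slope f l r = (f l - f r) / (l - r) := by rw [slope_comm, slope_def_field]
    rw [e] at h1 h2
    exact ⟨div_nonneg (by linarith) (by linarith), (div_le_one (by linarith)).mpr (by linarith)⟩
  -- For equal densities the outer denominator is zero, so the weight takes the default value `0`.
  · simp
  · have h1 := h.convex.convexOn.deriv_le_slope (mem_univ r) (mem_univ l) hlr (h.diff r)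
    have h2 := h.convex.convexOn.slope_le_deriv (mem_univ r) (mem_univ l) hlr (h.diff l)
    have h3 := h.strictMono_deriv hlr
    have e : slope f r l = (f l - f r) / (l - r) := by rw [slope_def_field]
    rw [e] at h1 h2
    exact ⟨div_nonneg_of_nonpos (by linarith) (by linarith),
      (div_le_one_of_neg (by linarith)).mpr (by linarith)⟩

end LegendreFunction

/-! ### Minimizers in the Hopf-Lax formula -/

/-- The hypotheses on the flux `f` and the initial potential `u₀` of the Hopf-Lax formula. -/
structure HopfLaxSetting (f u₀ : ℝ → ℝ) : Prop extends LegendreFunction f where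
  speed : 0 ≤ deriv f 0
  mono : Monotone u₀
  left : ∀ x, ContinuousWithinAt u₀ (Iic x) x
  growth : ∀ x t : ℝ, 0 < t → Tendsto (hopfLaxObjective f u₀ x t) atBot atTop

/-- `y` minimizes the Hopf-Lax objective over the whole line. -/
def IsHopfLaxMin (f u₀ : ℝ → ℝ) (x t y : ℝ) : Prop :=
  ∀ w, hopfLaxObjective f u₀ x t y ≤ hopfLaxObjective f u₀ x t w

namespace HopfLaxSetting

variable {f u₀ : ℝ → ℝ}

/-- Since `g'` inverts `f'`, the sign of `f'(0)` gives `g'(0) ≤ 0`, and `g` strictly decreases on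
the negative half-line. Thus points to the right of `x` never minimize, and the constraint `y ≤ x`
can be dropped. -/
theorem conjugate_zero_lt (h : HopfLaxSetting f u₀) {z : ℝ} (hz : z < 0) :
    convexConjugate f 0 < convexConjugate f z := by
  have h0 : deriv (convexConjugate f) 0 ≤ 0 := by
    by_contra! hlt
    have := h.strictMono_deriv hlt
    rw [h.deriv_deriv_conjugate] at this
    linarith [h.speed]
  have hanti : StrictAntiOn (convexConjugate f) (Iic 0) := by
    refine strictAntiOn_of_deriv_neg (convex_Iic 0) h.continuous_conjugate.continuousOn ?_
    intro w hw
    rw [interior_Iic] at hw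
    exact (h.strictMono_deriv_conjugate hw).trans_le h0
  exact hanti hz.le self_mem_Iic hz

theorem objective_lt_of_lt (h : HopfLaxSetting f u₀) {x t w : ℝ} (ht : 0 < t) (hw : x < w) :
    hopfLaxObjective f u₀ x t x < hopfLaxObjective f u₀ x t w := by
  have h1 : convexConjugate f ((x - x) / t) < convexConjugate f ((x - w) / t) := by
    rw [sub_self, zero_div]
    exact h.conjugate_zero_lt (div_neg_of_neg_of_pos (by linarith) ht)
  have := mul_lt_mul_of_pos_left h1 ht
  have := h.mono hw.le
  unfold hopfLaxObjective
  linarith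

theorem _root_.IsHopfLaxMin.le (h : HopfLaxSetting f u₀) {x t y : ℝ} (ht : 0 < t)
    (hy : IsHopfLaxMin f u₀ x t y) : y ≤ x := by
  by_contra! hlt
  exact absurd (hy x) (not_le.mpr (h.objective_lt_of_lt ht hlt))

/-- Left continuity controls the left side; on the right, monotonicity already gives larger values.
-/
theorem lowerSemicontinuous_initial (h : HopfLaxSetting f u₀) : LowerSemicontinuous u₀ := by
  intro y c hc
  have h1 : ∀ᶠ w in 𝓝[≤] y, c < u₀ w := (h.left y).eventually (lt_mem_nhds hc)
  have h2 : ∀ᶠ w in 𝓝[≥] y, c < u₀ w :=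
    eventually_mem_nhdsWithin.mono fun w hw => hc.trans_le (h.mono hw)
  rw [← nhdsLE_sup_nhdsGE]
  exact eventually_sup.mpr ⟨h1, h2⟩

theorem continuous_objective_conjugate (h : HopfLaxSetting f u₀) (x t : ℝ) :
    Continuous fun y => t * convexConjugate f ((x - y) / t) :=
  continuous_const.mul (h.continuous_conjugate.comp (by fun_prop))

theorem lowerSemicontinuous_objective (h : HopfLaxSetting f u₀) (x t : ℝ) :
    LowerSemicontinuous (hopfLaxObjective f u₀ x t) :=
  h.lowerSemicontinuous_initial.add (h.continuous_objective_conjugate x t).lowerSemicontinuous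

theorem exists_isHopfLaxMin (h : HopfLaxSetting f u₀) (x : ℝ) {t : ℝ} (ht : 0 < t) :
    ∃ y, IsHopfLaxMin f u₀ x t y := by
  obtain ⟨A, hA⟩ := eventually_atBot.mp
    ((h.growth x t ht).eventually_gt_atTop (hopfLaxObjective f u₀ x t x))
  have hAx : A ≤ x := by
    by_contra! hlt
    exact lt_irrefl _ (hA x hlt.le)
  obtain ⟨y, hy, hmin⟩ := LowerSemicontinuousOn.exists_isMinOn (nonempty_Icc.mpr hAx)
    isCompact_Icc ((h.lowerSemicontinuous_objective x t).lowerSemicontinuousOn _)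
  have hyx : hopfLaxObjective f u₀ x t y ≤ hopfLaxObjective f u₀ x t x :=
    hmin (right_mem_Icc.mpr hAx)
  refine ⟨y, fun w => ?_⟩
  rcases lt_or_ge w A with hw | hw
  · exact hyx.trans (hA w hw.le).le
  rcases le_or_gt w x with hx | hx
  · exact hmin ⟨hw, hx⟩
  · exact hyx.trans (h.objective_lt_of_lt ht hx).le

/-- All later arguments use minimality over the whole line, which allows arbitrary competitors; this
connects it with the constrained definition. -/
theorem mem_hopfLaxMinimizers_iff (h : HopfLaxSetting f u₀) {x t y : ℝ} (ht : 0 < t) :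
    y ∈ hopfLaxMinimizers f u₀ x t ↔ IsHopfLaxMin f u₀ x t y := by
  obtain ⟨m, hm⟩ := h.exists_isHopfLaxMin x ht
  have hu : hopfLax f u₀ x t = hopfLaxObjective f u₀ x t m := by
    refine le_antisymm (csInf_le ⟨hopfLaxObjective f u₀ x t m, ?_⟩ ⟨m, hm.le h ht, rfl⟩)
      (le_csInf ⟨_, m, hm.le h ht, rfl⟩ ?_)
    · rintro _ ⟨w, _, rfl⟩; exact hm w
    · rintro _ ⟨w, _, rfl⟩; exact hm w
  constructor
  · rintro ⟨_, hy⟩ w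
    rw [← hy, hu]; exact hm w
  · intro hy
    exact ⟨hy.le h ht, hu.trans (le_antisymm (hm y) (hy m))⟩

/-- Minimizers are closed under limits in all variables. -/
theorem isHopfLaxMin_of_tendsto (h : HopfLaxSetting f u₀) {ι : Type*} {l : Filter ι} [l.NeBot]
    {X T Y : ι → ℝ} {x t y : ℝ} (ht : 0 < t) (hX : Tendsto X l (𝓝 x)) (hT : Tendsto T l (𝓝 t))
    (hY : Tendsto Y l (𝓝 y)) (hmin : ∀ᶠ i in l, IsHopfLaxMin f u₀ (X i) (T i) (Y i)) :
    IsHopfLaxMin f u₀ x t y := by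
  have hG : ∀ {W : ι → ℝ} {w : ℝ}, Tendsto W l (𝓝 w) →
      Tendsto (fun i => T i * convexConjugate f ((X i - W i) / T i)) l
        (𝓝 (t * convexConjugate f ((x - w) / t))) := fun hW =>
    hT.mul ((h.continuous_conjugate.tendsto _).comp ((hX.sub hW).div hT ht.ne'))
  intro w
  unfold hopfLaxObjective
  by_contra! hlt
  -- The competitor `w` is fixed while the minimizers move. Their initial values therefore need only
  -- a lower bound in the limit, and the remaining terms are continuous.
  have hD := (hG hY).sub (hG (tendsto_const_nhds (x := w)))
  have hc : u₀ w - (t * convexConjugate f ((x - y) / t) - t * convexConjugate f ((x - w) / t)) <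
      u₀ y := by linarith
  obtain ⟨c, hc1, hc2⟩ := exists_between hc
  have e1 := hY.eventually (h.lowerSemicontinuous_initial y c hc2)
  have e2 := hD.eventually_const_lt (show u₀ w - c < _ by linarith)
  obtain ⟨i, hi1, hi2, hi3⟩ := (e1.and (e2.and hmin)).exists
  have := hi3 w
  unfold hopfLaxObjective at this
  linarith

/-- Minimizers are monotone in `x`. -/
theorem isHopfLaxMin_mono (h : HopfLaxSetting f u₀) {x x' t y y' : ℝ} (ht : 0 < t) (hx : x < x')
    (hy : IsHopfLaxMin f u₀ x t y) (hy' : IsHopfLaxMin f u₀ x' t y') : y ≤ y' := by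
  by_contra! hlt
  have h1 := hy y'
  have h2 := hy' y
  unfold hopfLaxObjective at h1 h2
  -- When the two minimality inequalities are added, the values of `u₀` cancel. What remains
  -- contradicts the strict growth of the increments of `g` over the length `(y - y') / t`.
  have hd : 0 < (y - y') / t := div_pos (by linarith) ht
  have h3 := h.strictMono_conjugate_shift_sub hd
    (show (x - y) / t < (x' - y) / t from div_lt_div_of_pos_right (by linarith) ht)
  have e1 : (x - y) / t + (y - y') / t = (x - y') / t := by ring
  have e2 : (x' - y) / t + (y - y') / t = (x' - y') / t := by ring
  simp only [e1, e2] at h3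
  have := mul_lt_mul_of_pos_left h3 ht
  linarith

/-- Along the segment from `(y, 0)` to `(x', t')`, the endpoint `y` is the only minimizer. -/
theorem eq_of_isHopfLaxMin_segment (h : HopfLaxSetting f u₀) {x' t t' y w : ℝ} (ht : 0 < t)
    (htt : t < t') (hy : IsHopfLaxMin f u₀ x' t' y)
    (hw : IsHopfLaxMin f u₀ (y + (x' - y) * t / t') t w) : w = y := by
  by_contra hne
  have ht' := ht.trans htt
  have e1 : (y + (x' - y) * t / t' - y) / t = (x' - y) / t' := by field_simp; ring
  have hneq : (y + (x' - y) * t / t' - w) / t ≠ (x' - y) / t' := by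
    rw [← e1]
    intro he
    rw [div_left_inj' ht.ne'] at he
    exact hne (by linarith)
  -- A path from `w` that joins the characteristic at time `t` has a kink if `w ≠ y`; the straight
  -- path from `w` to `(x', t')` is strictly cheaper, against the minimality of `y`.
  have h1 := h.perspective_lt ht htt hneq
  have e2 : (y + (x' - y) * t / t' - w + (t' - t) * ((x' - y) / t')) / t' = (x' - w) / t' := by
    field_simp; ring
  rw [e2] at h1
  have h2 := hw y
  have h3 := hy w
  unfold hopfLaxObjective at h2 h3
  rw [e1] at h2
  linarith

theorem isHopfLaxMin_segment (h : HopfLaxSetting f u₀) {x' t t' y : ℝ} (ht : 0 < t)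
    (htt : t < t') (hy : IsHopfLaxMin f u₀ x' t' y) :
    IsHopfLaxMin f u₀ (y + (x' - y) * t / t') t y := by
  obtain ⟨w, hw⟩ := h.exists_isHopfLaxMin (y + (x' - y) * t / t') ht
  rwa [h.eq_of_isHopfLaxMin_segment ht htt hy hw] at hw

/-- Minimizers at a fixed `x` are bounded below, uniformly on bounded time intervals. -/
theorem exists_lower_bound (h : HopfLaxSetting f u₀) (x₀ : ℝ) {T : ℝ} (hT : 0 < T) :
    ∃ A, ∀ x t y, x₀ < x → 0 < t → t ≤ T → IsHopfLaxMin f u₀ x t y → A ≤ y := by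
  obtain ⟨A, hA⟩ := eventually_atBot.mp
    ((h.growth x₀ T hT).eventually_gt_atTop (u₀ x₀ + T * convexConjugate f 0))
  refine ⟨A, fun x t y hx ht htT hy => ?_⟩
  obtain ⟨m, hm⟩ := h.exists_isHopfLaxMin x₀ ht
  refine le_trans ?_ (h.isHopfLaxMin_mono ht hx hm hy)
  by_contra! hlt
  have h1 := hA m hlt.le
  have h2 := hm x₀
  -- The cost in excess of `t g(0)` does not increase with `t`, so growth at the single time `T`
  -- serves every `t ≤ T`.
  have h3 := h.perspective_mono ht htT (x₀ - m)
  unfold hopfLaxObjective at h1 h2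
  rw [sub_self, zero_div] at h2
  linarith

theorem hopfLaxMinimizers_nonempty_bdd_closed (h : HopfLaxSetting f u₀) (x : ℝ) {t : ℝ} (ht : 0 < t) :
    (hopfLaxMinimizers f u₀ x t).Nonempty ∧ BddBelow (hopfLaxMinimizers f u₀ x t) ∧
      BddAbove (hopfLaxMinimizers f u₀ x t) ∧ IsClosed (hopfLaxMinimizers f u₀ x t) := by
  have e : hopfLaxMinimizers f u₀ x t = {y | IsHopfLaxMin f u₀ x t y} :=
    ext fun y => h.mem_hopfLaxMinimizers_iff ht
  rw [e]
  obtain ⟨A, hA⟩ := h.exists_lower_bound (x - 1) ht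
  refine ⟨h.exists_isHopfLaxMin x ht, ⟨A, fun y hy => hA x t y (by linarith) ht le_rfl hy⟩,
    ⟨x, fun y hy => IsHopfLaxMin.le h ht hy⟩, ?_⟩
  rw [isClosed_iff_clusterPt]
  intro y hy
  have : (𝓝 y ⊓ 𝓟 {y | IsHopfLaxMin f u₀ x t y}).NeBot := hy
  refine h.isHopfLaxMin_of_tendsto ht tendsto_const_nhds tendsto_const_nhds
    (tendsto_id.mono_left inf_le_left)
    (l := 𝓝 y ⊓ 𝓟 {y | IsHopfLaxMin f u₀ x t y}) ?_
  exact (eventually_principal.mpr fun y hy => hy).filter_mono inf_le_right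

theorem isHopfLaxMin_yMinus (h : HopfLaxSetting f u₀) (x : ℝ) {t : ℝ} (ht : 0 < t) :
    IsHopfLaxMin f u₀ x t (yMinus f u₀ x t) :=
  let ⟨h1, h2, _, h4⟩ := h.hopfLaxMinimizers_nonempty_bdd_closed x ht
  (h.mem_hopfLaxMinimizers_iff ht).mp (h4.csInf_mem h1 h2)

theorem isHopfLaxMin_yPlus (h : HopfLaxSetting f u₀) (x : ℝ) {t : ℝ} (ht : 0 < t) :
    IsHopfLaxMin f u₀ x t (yPlus f u₀ x t) :=
  let ⟨h1, _, h3, h4⟩ := h.hopfLaxMinimizers_nonempty_bdd_closed x ht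
  (h.mem_hopfLaxMinimizers_iff ht).mp (h4.csSup_mem h1 h3)

theorem yMinus_le (h : HopfLaxSetting f u₀) {x t y : ℝ} (ht : 0 < t)
    (hy : IsHopfLaxMin f u₀ x t y) : yMinus f u₀ x t ≤ y :=
  csInf_le (h.hopfLaxMinimizers_nonempty_bdd_closed x ht).2.1 ((h.mem_hopfLaxMinimizers_iff ht).mpr hy)

theorem le_yPlus (h : HopfLaxSetting f u₀) {x t y : ℝ} (ht : 0 < t)
    (hy : IsHopfLaxMin f u₀ x t y) : y ≤ yPlus f u₀ x t :=
  le_csSup (h.hopfLaxMinimizers_nonempty_bdd_closed x ht).2.2.1 ((h.mem_hopfLaxMinimizers_iff ht).mpr hy)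

theorem yMinus_le_yPlus (h : HopfLaxSetting f u₀) (x : ℝ) {t : ℝ} (ht : 0 < t) :
    yMinus f u₀ x t ≤ yPlus f u₀ x t :=
  h.yMinus_le ht (h.isHopfLaxMin_yPlus x ht)

theorem yPlus_le (h : HopfLaxSetting f u₀) (x : ℝ) {t : ℝ} (ht : 0 < t) :
    yPlus f u₀ x t ≤ x := (h.isHopfLaxMin_yPlus x ht).le h ht

theorem yPlus_le_yMinus (h : HopfLaxSetting f u₀) {x x' t : ℝ} (ht : 0 < t) (hx : x < x') :
    yPlus f u₀ x t ≤ yMinus f u₀ x' t :=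
  h.isHopfLaxMin_mono ht hx (h.isHopfLaxMin_yPlus x ht) (h.isHopfLaxMin_yMinus x' ht)

theorem monotone_yMinus (h : HopfLaxSetting f u₀) {t : ℝ} (ht : 0 < t) :
    Monotone fun x => yMinus f u₀ x t :=
  monotone_iff_forall_lt.mpr fun x _ hx =>
    (h.yMinus_le_yPlus x ht).trans (h.yPlus_le_yMinus ht hx)

theorem monotone_yPlus (h : HopfLaxSetting f u₀) {t : ℝ} (ht : 0 < t) :
    Monotone fun x => yPlus f u₀ x t :=
  monotone_iff_forall_lt.mpr fun _ x' hx =>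
    (h.yPlus_le_yMinus ht hx).trans (h.yMinus_le_yPlus x' ht)

theorem deriv_rhoPlus (h : HopfLaxSetting f u₀) (x t : ℝ) :
    deriv f (rhoPlus f u₀ x t) = (x - yPlus f u₀ x t) / t := h.deriv_deriv_conjugate _

theorem deriv_rhoMinus (h : HopfLaxSetting f u₀) (x t : ℝ) :
    deriv f (rhoMinus f u₀ x t) = (x - yMinus f u₀ x t) / t := h.deriv_deriv_conjugate _

/-- Minimizers converge to `yMinus` if they stay below it. -/
theorem tendsto_yMinus (h : HopfLaxSetting f u₀) {ι : Type*} {l : Filter ι}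
    {X T Y : ι → ℝ} {x t A : ℝ} (ht : 0 < t) (hX : Tendsto X l (𝓝 x)) (hT : Tendsto T l (𝓝 t))
    (hmin : ∀ᶠ i in l, IsHopfLaxMin f u₀ (X i) (T i) (Y i)) (hA : ∀ᶠ i in l, A ≤ Y i)
    (hle : ∀ᶠ i in l, Y i ≤ yMinus f u₀ x t) : Tendsto Y l (𝓝 (yMinus f u₀ x t)) := by
  -- Every cluster point is a minimizer at `(x, t)`, hence at least `y⁻`, and by `hle` at most `y⁻`.
  refine (isCompact_Icc (a := A) (b := yMinus f u₀ x t)).tendsto_nhds_of_unique_mapClusterPt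
    (hA.and hle) fun y hy hcl => ?_
  obtain ⟨U, hU, hlim⟩ := mapClusterPt_iff_ultrafilter.mp hcl
  refine le_antisymm hy.2 (h.yMinus_le ht ?_)
  exact h.isHopfLaxMin_of_tendsto ht (hX.mono_left hU) (hT.mono_left hU) hlim (hU hmin)

/-- Minimizers converge to `yPlus` if they stay above it. -/
theorem tendsto_yPlus (h : HopfLaxSetting f u₀) {ι : Type*} {l : Filter ι}
    {X T Y : ι → ℝ} {x t B : ℝ} (ht : 0 < t) (hX : Tendsto X l (𝓝 x)) (hT : Tendsto T l (𝓝 t))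
    (hmin : ∀ᶠ i in l, IsHopfLaxMin f u₀ (X i) (T i) (Y i)) (hB : ∀ᶠ i in l, Y i ≤ B)
    (hle : ∀ᶠ i in l, yPlus f u₀ x t ≤ Y i) : Tendsto Y l (𝓝 (yPlus f u₀ x t)) := by
  refine (isCompact_Icc (a := yPlus f u₀ x t) (b := B)).tendsto_nhds_of_unique_mapClusterPt
    (hle.and hB) fun y hy hcl => ?_
  obtain ⟨U, hU, hlim⟩ := mapClusterPt_iff_ultrafilter.mp hcl
  refine le_antisymm (h.le_yPlus ht ?_) hy.1
  exact h.isHopfLaxMin_of_tendsto ht (hX.mono_left hU) (hT.mono_left hU) hlim (hU hmin)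

/-- Minimizers at `z > x` lie above all minimizers at `x`, and their limit is itself a minimizer at
`x`, hence the largest. With its companions this determines the one-sided limits of `f'(ρ⁺)` in `x`.
-/
theorem tendsto_yMinus_right (h : HopfLaxSetting f u₀) (x : ℝ) {t : ℝ} (ht : 0 < t) :
    Tendsto (fun z => yMinus f u₀ z t) (𝓝[>] x) (𝓝 (yPlus f u₀ x t)) := by
  refine h.tendsto_yPlus (B := x + 1) ht (tendsto_id.mono_left nhdsWithin_le_nhds)
    (tendsto_const_nhds (x := t))
    (Eventually.of_forall fun z => h.isHopfLaxMin_yMinus z ht) ?_ ?_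
  · filter_upwards [mem_nhdsWithin_of_mem_nhds (Iic_mem_nhds (lt_add_one x))] with z hz
    exact ((h.isHopfLaxMin_yMinus z ht).le h ht).trans hz
  · filter_upwards [self_mem_nhdsWithin] with z hz using h.yPlus_le_yMinus ht hz

theorem tendsto_yPlus_right (h : HopfLaxSetting f u₀) (x : ℝ) {t : ℝ} (ht : 0 < t) :
    Tendsto (fun z => yPlus f u₀ z t) (𝓝[>] x) (𝓝 (yPlus f u₀ x t)) := by
  refine h.tendsto_yPlus (B := x + 1) ht (tendsto_id.mono_left nhdsWithin_le_nhds)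
    (tendsto_const_nhds (x := t))
    (Eventually.of_forall fun z => h.isHopfLaxMin_yPlus z ht) ?_ ?_
  · filter_upwards [mem_nhdsWithin_of_mem_nhds (Iic_mem_nhds (lt_add_one x))] with z hz
    exact (h.yPlus_le z ht).trans hz
  · filter_upwards [self_mem_nhdsWithin] with z hz using h.monotone_yPlus ht (le_of_lt hz)

theorem tendsto_yPlus_left (h : HopfLaxSetting f u₀) (x : ℝ) {t : ℝ} (ht : 0 < t) :
    Tendsto (fun z => yPlus f u₀ z t) (𝓝[<] x) (𝓝 (yMinus f u₀ x t)) := by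
  obtain ⟨A, hA⟩ := h.exists_lower_bound (x - 1) ht
  refine h.tendsto_yMinus (A := A) ht (tendsto_id.mono_left nhdsWithin_le_nhds)
    (tendsto_const_nhds (x := t))
    (Eventually.of_forall fun z => h.isHopfLaxMin_yPlus z ht) ?_ ?_
  · filter_upwards [mem_nhdsWithin_of_mem_nhds (Ioi_mem_nhds (sub_one_lt x))] with z hz
    exact hA z t _ hz ht le_rfl (h.isHopfLaxMin_yPlus z ht)
  · filter_upwards [self_mem_nhdsWithin] with z hz using h.yPlus_le_yMinus ht hz

/-- Minimizers at `(x, t)` converge to `x` as `t` tends to zero. -/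
theorem tendsto_of_isHopfLaxMin (h : HopfLaxSetting f u₀) {x : ℝ} {Y : ℝ → ℝ}
    (hY : ∀ t, 0 < t → IsHopfLaxMin f u₀ x t (Y t)) : Tendsto Y (𝓝[>] 0) (𝓝 x) := by
  obtain ⟨A, hA⟩ := h.exists_lower_bound (x - 1) one_pos
  rw [tendsto_order]
  refine ⟨fun a ha => ?_, fun b hb => ?_⟩
  · set C := u₀ x - u₀ A
    -- With this slope a foot point at or below `a` costs at least `|C| + 1` minus `t f(ρ)`. The
    -- possible gain in `u₀` is at most `|C|`, and the terms of order `t` stay below `1`.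
    obtain ⟨ρ, hρ⟩ : ∃ ρ, ρ = (|C| + 1) / (x - a) := ⟨_, rfl⟩
    have hxa : 0 < x - a := sub_pos.mpr ha
    have hρ0 : 0 ≤ ρ := by rw [hρ]; positivity
    have hlim : Tendsto (fun t : ℝ => t * (convexConjugate f 0 + f ρ)) (𝓝[>] 0) (𝓝 0) := by
      have : Continuous fun t : ℝ => t * (convexConjugate f 0 + f ρ) := by fun_prop
      simpa using (this.tendsto 0).mono_left nhdsWithin_le_nhds
    filter_upwards [hlim.eventually_lt_const one_pos, self_mem_nhdsWithin,
      mem_nhdsWithin_of_mem_nhds (Iic_mem_nhds (zero_lt_one' ℝ))] with t ht1 (ht : 0 < t) ht2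
    by_contra! hlt
    have hAY := hA x t _ (by linarith) ht ht2 (hY t ht)
    have h1 := hY t ht x
    have h2 := h.le_perspective ht (x - Y t) ρ
    have h3 := h.mono hAY
    unfold hopfLaxObjective at h1
    rw [sub_self, zero_div] at h1
    have h4 : (x - a) * ρ ≤ (x - Y t) * ρ := mul_le_mul_of_nonneg_right (by linarith) hρ0
    have h5 : (x - a) * ρ = |C| + 1 := by rw [hρ]; field_simp
    have h6 := le_abs_self C
    have h7 : u₀ x - u₀ A ≤ |C| := h6
    linarith
  · filter_upwards [self_mem_nhdsWithin] with t ht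
    exact ((hY t ht).le h ht).trans_lt hb

end HopfLaxSetting

/-! ### Fronts: the curves `t ↦ X(t)` separating minimizers below and above a level `a` -/

/-- The rightmost point at time `t` with a Hopf-Lax minimizer at most `a`. -/
noncomputable def hopfLaxFront (f u₀ : ℝ → ℝ) (a t : ℝ) : ℝ := sSup {x | yMinus f u₀ x t ≤ a}

/-- The weighted mean `θ f'(ρ⁻) + (1 - θ) f'(ρ⁺)` of the characteristic speeds at `(x, t)`. -/
noncomputable def meanSpeed (f u₀ : ℝ → ℝ) (x t : ℝ) : ℝ :=
  shockWeight f (rhoPlus f u₀ x t) (rhoMinus f u₀ x t) * ((x - yMinus f u₀ x t) / t) +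
    (1 - shockWeight f (rhoPlus f u₀ x t) (rhoMinus f u₀ x t)) * ((x - yPlus f u₀ x t) / t)

namespace HopfLaxSetting

variable {f u₀ : ℝ → ℝ}

/-- Moving the foot point from some `y ≤ a` to `a + 1` saves at least `g'((x - (a + 1)) / t)` once
this slope is nonnegative. The saving tends to infinity with `x`, while the loss in `u₀` is at most
`u₀ (a + 1) - u₀ A`. -/
theorem exists_lt_yMinus (h : HopfLaxSetting f u₀) (a : ℝ) {t : ℝ} (ht : 0 < t) :
    ∃ x, a < yMinus f u₀ x t := by
  obtain ⟨A, hA⟩ := h.exists_lower_bound a ht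
  have hlim : Tendsto (fun x => deriv (convexConjugate f) ((x - (a + 1)) / t)) atTop atTop :=
    h.tendsto_deriv_conjugate_atTop.comp
      ((tendsto_atTop_add_const_right _ (-(a + 1)) tendsto_id).atTop_div_const ht)
  obtain ⟨x, hx1, hx2, hx3⟩ := ((hlim.eventually_gt_atTop (u₀ (a + 1) - u₀ A)).and
    ((hlim.eventually_ge_atTop 0).and (eventually_gt_atTop a))).exists
  refine ⟨x, ?_⟩
  by_contra! hle
  set y := yMinus f u₀ x t
  set ρ := deriv (convexConjugate f) ((x - (a + 1)) / t)
  have h1 := h.isHopfLaxMin_yMinus x ht (a + 1)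
  have h2 := h.mono (hA x t _ hx3 ht le_rfl (h.isHopfLaxMin_yMinus x ht))
  have h3 := h.le_perspective ht (x - y) ρ
  have h4 := h.perspective_eq ht (x - (a + 1))
  have h5 : 1 * ρ ≤ (a + 1 - y) * ρ := mul_le_mul_of_nonneg_right (by linarith) hx2
  unfold hopfLaxObjective at h1
  change u₀ y + t * convexConjugate f ((x - y) / t) ≤ _ at h1
  change u₀ A ≤ u₀ y at h2
  change _ = _ * ρ - t * f ρ at h4
  linarith

theorem bddAbove_front (h : HopfLaxSetting f u₀) (a : ℝ) {t : ℝ} (ht : 0 < t) :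
    BddAbove {x | yMinus f u₀ x t ≤ a} := by
  obtain ⟨z, hz⟩ := h.exists_lt_yMinus a ht
  refine ⟨z, fun x hx => ?_⟩
  by_contra! hlt
  exact absurd (h.monotone_yMinus ht hlt.le) (not_le.mpr (lt_of_le_of_lt hx hz))

theorem le_front (h : HopfLaxSetting f u₀) (a : ℝ) {t : ℝ} (ht : 0 < t) :
    a ≤ hopfLaxFront f u₀ a t :=
  le_csSup (h.bddAbove_front a ht) ((h.isHopfLaxMin_yMinus a ht).le h ht)

theorem yPlus_le_of_lt_front (h : HopfLaxSetting f u₀) {a x t : ℝ} (ht : 0 < t)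
    (hx : x < hopfLaxFront f u₀ a t) : yPlus f u₀ x t ≤ a := by
  have hne : {x | yMinus f u₀ x t ≤ a}.Nonempty := ⟨a, (h.isHopfLaxMin_yMinus a ht).le h ht⟩
  obtain ⟨z, hz, hxz⟩ := exists_lt_of_lt_csSup hne hx
  exact (h.yPlus_le_yMinus ht hxz).trans hz

/-- The supremum defining the front is attained, because minimizers to the left of a point converge
to its `yMinus`. -/
theorem yMinus_le_iff (h : HopfLaxSetting f u₀) {a x t : ℝ} (ht : 0 < t) :
    yMinus f u₀ x t ≤ a ↔ x ≤ hopfLaxFront f u₀ a t := by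
  refine ⟨fun hx => le_csSup (h.bddAbove_front a ht) hx, fun hx => ?_⟩
  refine (h.monotone_yMinus ht hx).trans ?_
  refine le_of_tendsto (h.tendsto_yPlus_left (hopfLaxFront f u₀ a t) ht) ?_
  filter_upwards [self_mem_nhdsWithin] with z hz using h.yPlus_le_of_lt_front ht hz

theorem lt_yMinus_iff (h : HopfLaxSetting f u₀) {a x t : ℝ} (ht : 0 < t) :
    a < yMinus f u₀ x t ↔ hopfLaxFront f u₀ a t < x := by
  rw [← not_le, ← not_le, h.yMinus_le_iff ht]

theorem yMinus_front_le (h : HopfLaxSetting f u₀) (a : ℝ) {t : ℝ} (ht : 0 < t) :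
    yMinus f u₀ (hopfLaxFront f u₀ a t) t ≤ a := (h.yMinus_le_iff ht).mpr le_rfl

theorem le_yPlus_front (h : HopfLaxSetting f u₀) (a : ℝ) {t : ℝ} (ht : 0 < t) :
    a ≤ yPlus f u₀ (hopfLaxFront f u₀ a t) t := by
  refine ge_of_tendsto (h.tendsto_yMinus_right (hopfLaxFront f u₀ a t) ht) ?_
  filter_upwards [self_mem_nhdsWithin] with z hz using ((h.lt_yMinus_iff ht).mpr hz).le

/-- The characteristic issuing from `yMinus` at a later front point lies left of the front. -/
theorem segment_yMinus_le_front (h : HopfLaxSetting f u₀) (a : ℝ) {t s : ℝ} (ht : 0 < t)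
    (hts : t < s) :
    yMinus f u₀ (hopfLaxFront f u₀ a s) s +
      (hopfLaxFront f u₀ a s - yMinus f u₀ (hopfLaxFront f u₀ a s) s) * t / s ≤
      hopfLaxFront f u₀ a t := by
  have hs := ht.trans hts
  rw [← h.yMinus_le_iff ht]
  exact (h.yMinus_le ht (h.isHopfLaxMin_segment ht hts (h.isHopfLaxMin_yMinus _ hs))).trans
    (h.yMinus_front_le a hs)

/-- The characteristic issuing from `yPlus` at a later front point lies right of the front. -/
theorem front_le_segment_yPlus (h : HopfLaxSetting f u₀) (a : ℝ) {t s : ℝ} (ht : 0 < t)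
    (hts : t < s) :
    hopfLaxFront f u₀ a t ≤ yPlus f u₀ (hopfLaxFront f u₀ a s) s +
      (hopfLaxFront f u₀ a s - yPlus f u₀ (hopfLaxFront f u₀ a s) s) * t / s := by
  have hs := ht.trans hts
  set X := hopfLaxFront f u₀ a s
  have h1 := h.tendsto_yMinus_right X hs
  have h2 : Tendsto (fun z : ℝ => z) (𝓝[>] X) (𝓝 X) := tendsto_id.mono_left nhdsWithin_le_nhds
  -- The claim is proved for `z` strictly to the right of the front, where `yMinus` exceeds `a`;
  -- then `z` decreases to the front.
  refine ge_of_tendsto (h1.add (((h2.sub h1).mul_const t).div_const s)) ?_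
  filter_upwards [self_mem_nhdsWithin] with z hz
  have hm := h.isHopfLaxMin_segment ht hts (h.isHopfLaxMin_yMinus z hs)
  have e := h.eq_of_isHopfLaxMin_segment ht hts (h.isHopfLaxMin_yMinus z hs)
    (h.isHopfLaxMin_yMinus _ ht)
  refine ((h.lt_yMinus_iff ht).mp ?_).le
  rw [e]
  exact (h.lt_yMinus_iff hs).mpr hz

/-- Followed back to time `t`, the left characteristic of the later front point lies left of the
front and still carries its foot as unique minimizer. Monotonicity in `x` compares this foot with
the earlier one. -/
theorem yMinus_front_anti (h : HopfLaxSetting f u₀) (a : ℝ) {t s : ℝ} (ht : 0 < t)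
    (hts : t < s) :
    yMinus f u₀ (hopfLaxFront f u₀ a s) s ≤ yMinus f u₀ (hopfLaxFront f u₀ a t) t := by
  have hs := ht.trans hts
  rw [← h.eq_of_isHopfLaxMin_segment ht hts (h.isHopfLaxMin_yMinus _ hs)
    (h.isHopfLaxMin_yMinus _ ht)]
  exact h.monotone_yMinus ht (h.segment_yMinus_le_front a ht hts)

theorem yPlus_front_mono (h : HopfLaxSetting f u₀) (a : ℝ) {t s : ℝ} (ht : 0 < t)
    (hts : t < s) :
    yPlus f u₀ (hopfLaxFront f u₀ a t) t ≤ yPlus f u₀ (hopfLaxFront f u₀ a s) s := by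
  have hs := ht.trans hts
  rw [← h.eq_of_isHopfLaxMin_segment ht hts (h.isHopfLaxMin_yPlus _ hs)
    (h.isHopfLaxMin_yPlus (_ + _) ht)]
  exact h.monotone_yPlus ht (h.front_le_segment_yPlus a ht hts)

theorem front_mono (h : HopfLaxSetting f u₀) (a : ℝ) {t s : ℝ} (ht : 0 < t) (hts : t < s) :
    hopfLaxFront f u₀ a t ≤ hopfLaxFront f u₀ a s := by
  have hs := ht.trans hts
  refine (h.front_le_segment_yPlus a ht hts).trans ?_
  have h1 := h.yPlus_le (hopfLaxFront f u₀ a s) hs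
  have h2 : (hopfLaxFront f u₀ a s - yPlus f u₀ (hopfLaxFront f u₀ a s) s) * t / s ≤
      hopfLaxFront f u₀ a s - yPlus f u₀ (hopfLaxFront f u₀ a s) s := by
    rw [div_le_iff₀ hs]
    exact mul_le_mul_of_nonneg_left hts.le (by linarith)
  linarith

theorem front_monotoneOn (h : HopfLaxSetting f u₀) (a : ℝ) :
    MonotoneOn (hopfLaxFront f u₀ a) (Ioi 0) := by
  intro t ht s _ hts
  rcases hts.eq_or_lt with rfl | hlt
  · exact le_rfl
  · exact h.front_mono a ht hlt

/-- `segment_yMinus_le_front` with denominators cleared. This bound and `le_front_sub` enclose the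
difference quotient between characteristic speeds, which settles continuity and the velocity where
the minimizer is unique. -/
theorem front_sub_le (h : HopfLaxSetting f u₀) (a : ℝ) {t s : ℝ} (ht : 0 < t) (hts : t < s) :
    (hopfLaxFront f u₀ a s - hopfLaxFront f u₀ a t) * t ≤
      (hopfLaxFront f u₀ a t - yMinus f u₀ (hopfLaxFront f u₀ a s) s) * (s - t) := by
  have hs := ht.trans hts
  have h1 := mul_le_mul_of_nonneg_right (h.segment_yMinus_le_front a ht hts) hs.le
  rw [add_mul, div_mul_cancel₀ _ hs.ne'] at h1
  linarith

theorem le_front_sub (h : HopfLaxSetting f u₀) (a : ℝ) {t s : ℝ} (ht : 0 < t) (hts : t < s) :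
    (hopfLaxFront f u₀ a t - yPlus f u₀ (hopfLaxFront f u₀ a s) s) * (s - t) ≤
      (hopfLaxFront f u₀ a s - hopfLaxFront f u₀ a t) * t := by
  have hs := ht.trans hts
  have h1 := mul_le_mul_of_nonneg_right (h.front_le_segment_yPlus a ht hts) hs.le
  rw [add_mul, div_mul_cancel₀ _ hs.ne'] at h1
  linarith

theorem exists_lower_bound_front (h : HopfLaxSetting f u₀) (a : ℝ) {T : ℝ} (hT : 0 < T) :
    ∃ A, ∀ t, 0 < t → t ≤ T → A ≤ yMinus f u₀ (hopfLaxFront f u₀ a t) t := by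
  obtain ⟨A, hA⟩ := h.exists_lower_bound (a - 1) hT
  exact ⟨A, fun t ht htT => hA _ t _ (by linarith [h.le_front a ht]) ht htT
    (h.isHopfLaxMin_yMinus _ ht)⟩

theorem continuousOn_front (h : HopfLaxSetting f u₀) (a : ℝ) :
    ContinuousOn (hopfLaxFront f u₀ a) (Ioi 0) := by
  intro t (ht : 0 < t)
  have hT : 0 < t + 1 := by linarith
  have hε : 0 < t / 2 := by linarith
  obtain ⟨A, hA⟩ := h.exists_lower_bound_front a hT
  -- The slope bound of `front_sub_le`, made uniform on `[t/2, t + 1]`: largest front position,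
  -- lowest minimizer, earliest time.
  set K := (hopfLaxFront f u₀ a (t + 1) - A) / (t / 2)
  have hlip : ∀ p ∈ Icc (t / 2) (t + 1), ∀ q ∈ Icc (t / 2) (t + 1), p < q →
      |hopfLaxFront f u₀ a q - hopfLaxFront f u₀ a p| ≤ K * (q - p) := by
    intro p hp q hq hpq
    have hp0 : 0 < p := hε.trans_le hp.1
    have hq0 : 0 < q := hε.trans_le hq.1
    have hmono := h.front_mono a hp0 hpq
    rw [abs_of_nonneg (by linarith)]
    have h1 := h.front_sub_le a hp0 hpq
    have h2 := hA q hq0 hq.2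
    have h3 := h.front_monotoneOn a hp0 hT hp.2
    have h4 : (hopfLaxFront f u₀ a p - yMinus f u₀ (hopfLaxFront f u₀ a q) q) * (q - p) ≤
        (hopfLaxFront f u₀ a (t + 1) - A) * (q - p) :=
      mul_le_mul_of_nonneg_right (by linarith) (by linarith)
    have h5 : (hopfLaxFront f u₀ a q - hopfLaxFront f u₀ a p) * (t / 2) ≤
        (hopfLaxFront f u₀ a q - hopfLaxFront f u₀ a p) * p :=
      mul_le_mul_of_nonneg_left hp.1 (by linarith)
    rw [div_mul_eq_mul_div, le_div_iff₀ hε]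
    linarith
  have hK : LipschitzOnWith (Real.toNNReal K) (hopfLaxFront f u₀ a) (Icc (t / 2) (t + 1)) := by
    refine LipschitzOnWith.of_dist_le_mul fun p hp q hq => ?_
    rw [Real.dist_eq, Real.dist_eq]
    have hle : K ≤ (Real.toNNReal K : ℝ) := Real.le_coe_toNNReal K
    rcases lt_trichotomy p q with hpq | rfl | hpq
    · have := hlip p hp q hq hpq
      rw [abs_sub_comm, abs_sub_comm p, abs_of_pos (sub_pos.mpr hpq)]
      exact this.trans (mul_le_mul_of_nonneg_right hle (by linarith))
    · simp
    · have := hlip q hq p hp hpq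
      rw [abs_of_pos (sub_pos.mpr hpq)]
      exact this.trans (mul_le_mul_of_nonneg_right hle (by linarith))
  exact (hK.continuousOn.continuousAt (Icc_mem_nhds (by linarith) (by linarith))).continuousWithinAt

/-- Change of the Hopf-Lax value between two points, compared for two minimizers. -/
theorem linearized_le (h : HopfLaxSetting f u₀) {x x' t t' y y' : ℝ} (ht : 0 < t) (ht' : 0 < t')
    (hy : IsHopfLaxMin f u₀ x t y) (hy' : IsHopfLaxMin f u₀ x' t' y') :
    (x' - x) * deriv (convexConjugate f) ((x - y') / t) -
        (t' - t) * f (deriv (convexConjugate f) ((x - y') / t)) ≤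
      (x' - x) * deriv (convexConjugate f) ((x' - y) / t') -
        (t' - t) * f (deriv (convexConjugate f) ((x' - y) / t')) := by
  have h1 := hy y'
  have h2 := hy' y
  unfold hopfLaxObjective at h1 h2
  -- Each foot point is seen from both space-time points. The affine function exact at one of them
  -- bounds the perspective from below at the other, so only terms linear in `(x' - x, t' - t)`
  -- survive.
  have h3 := h.le_perspective ht' (x' - y') (deriv (convexConjugate f) ((x - y') / t))
  have h4 := h.le_perspective ht (x - y) (deriv (convexConjugate f) ((x' - y) / t'))
  have h5 := h.perspective_eq ht (x - y')
  have h6 := h.perspective_eq ht' (x' - y)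
  linarith

/-- Rankine-Hugoniot condition: fronts have the mean speed as right derivative. -/
theorem hasDerivWithinAt_front (h : HopfLaxSetting f u₀) (a : ℝ) {t : ℝ} (ht : 0 < t) :
    HasDerivWithinAt (hopfLaxFront f u₀ a) (meanSpeed f u₀ (hopfLaxFront f u₀ a t) t)
      (Ioi t) t := by
  have hT : 0 < t + 1 := by linarith
  set X := hopfLaxFront f u₀ a
  set r := deriv (convexConjugate f)
  have hrc : Continuous r := h.continuous_deriv_conjugate
  have hs : Tendsto (fun s : ℝ => s) (𝓝[>] t) (𝓝 t) := tendsto_id.mono_left nhdsWithin_le_nhds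
  have hX : Tendsto X (𝓝[>] t) (𝓝 (X t)) :=
    ((h.continuousOn_front a).continuousAt (Ioi_mem_nhds ht)).tendsto.mono_left nhdsWithin_le_nhds
  obtain ⟨A, hA⟩ := h.exists_lower_bound_front a hT
  have hnear : ∀ᶠ s in 𝓝[>] t, t < s ∧ 0 < s ∧ s ≤ t + 1 := by
    filter_upwards [self_mem_nhdsWithin,
      mem_nhdsWithin_of_mem_nhds (Iic_mem_nhds (lt_add_one t))] with s hs1 hs2
    exact ⟨hs1, ht.trans hs1, hs2⟩
  have hm : Tendsto (fun s => yMinus f u₀ (X s) s) (𝓝[>] t) (𝓝 (yMinus f u₀ (X t) t)) :=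
    h.tendsto_yMinus ht hX hs (hnear.mono fun s hs => h.isHopfLaxMin_yMinus _ hs.2.1)
      (hnear.mono fun s hs => hA s hs.2.1 hs.2.2)
      (hnear.mono fun s hs => h.yMinus_front_anti a ht hs.1)
  have hp : Tendsto (fun s => yPlus f u₀ (X s) s) (𝓝[>] t) (𝓝 (yPlus f u₀ (X t) t)) :=
    h.tendsto_yPlus (B := X (t + 1)) ht hX hs
      (hnear.mono fun s hs => h.isHopfLaxMin_yPlus _ hs.2.1)
      (hnear.mono fun s hs => (h.yPlus_le _ hs.2.1).trans
        (h.front_monotoneOn a hs.2.1 hT hs.2.2))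
      (hnear.mono fun s hs => h.yPlus_front_mono a ht hs.1)
  rw [hasDerivWithinAt_iff_tendsto_slope' self_notMem_Ioi]
  -- With a unique minimizer both characteristic speeds have the same limit. At a shock the speeds
  -- differ, and the comparison of Hopf-Lax values is needed instead.
  rcases (h.yMinus_le_yPlus (X t) ht).eq_or_lt with heq | hlt
  · have e : meanSpeed f u₀ (X t) t = (X t - yMinus f u₀ (X t) t) / t := by
      unfold meanSpeed; rw [← heq]; ring
    have lim1 := (hp.const_sub (X t)).div_const t
    have lim2 := (hm.const_sub (X t)).div_const t
    rw [← heq] at lim1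
    rw [e]
    refine tendsto_of_tendsto_of_tendsto_of_le_of_le' lim1 lim2 ?_ ?_
    · filter_upwards [hnear] with s hs
      rw [slope_def_field, div_le_div_iff₀ ht (by linarith [hs.1])]
      exact h.le_front_sub a ht hs.1
    · filter_upwards [hnear] with s hs
      rw [slope_def_field, div_le_div_iff₀ (by linarith [hs.1]) ht]
      exact h.front_sub_le a ht hs.1
  · set ym := yMinus f u₀ (X t) t
    set yp := yPlus f u₀ (X t) t
    have hρ : rhoPlus f u₀ (X t) t < rhoMinus f u₀ (X t) t :=
      h.strictMono_deriv_conjugate (div_lt_div_of_pos_right (by linarith) ht)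
    have e : meanSpeed f u₀ (X t) t =
        (f (rhoMinus f u₀ (X t) t) - f (rhoPlus f u₀ (X t) t)) /
          (rhoMinus f u₀ (X t) t - rhoPlus f u₀ (X t) t) := by
      have hsp := shockWeight_spec f (rhoPlus f u₀ (X t) t) (rhoMinus f u₀ (X t) t)
        (h.strictMono_deriv hρ).ne
      rw [h.deriv_rhoPlus, h.deriv_rhoMinus] at hsp
      rw [meanSpeed, ← hsp, ← neg_div_neg_eq, neg_sub, neg_sub]
    have hfc := h.diff.continuous
    have l1 : Tendsto (fun s => r ((X t - yMinus f u₀ (X s) s) / t)) (𝓝[>] t)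
        (𝓝 (rhoMinus f u₀ (X t) t)) :=
      (hrc.tendsto _).comp ((hm.const_sub (X t)).div_const t)
    have l2 : Tendsto (fun s => r ((X s - yp) / s)) (𝓝[>] t) (𝓝 (rhoPlus f u₀ (X t) t)) :=
      (hrc.tendsto _).comp ((hX.sub_const yp).div hs ht.ne')
    have l3 : Tendsto (fun s => r ((X t - yPlus f u₀ (X s) s) / t)) (𝓝[>] t)
        (𝓝 (rhoPlus f u₀ (X t) t)) :=
      (hrc.tendsto _).comp ((hp.const_sub (X t)).div_const t)
    have l4 : Tendsto (fun s => r ((X s - ym) / s)) (𝓝[>] t) (𝓝 (rhoMinus f u₀ (X t) t)) :=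
      (hrc.tendsto _).comp ((hX.sub_const ym).div hs ht.ne')
    have hne : rhoMinus f u₀ (X t) t - rhoPlus f u₀ (X t) t ≠ 0 := (sub_pos.mpr hρ).ne'
    have lim1 := (((hfc.tendsto _).comp l4).sub ((hfc.tendsto _).comp l3)).div (l4.sub l3) hne
    have lim2 := (((hfc.tendsto _).comp l1).sub ((hfc.tendsto _).comp l2)).div (l1.sub l2) hne
    rw [e]
    -- Pairing `y⁻` now with `y⁺` later bounds the slope from below; the opposite pairing bounds it
    -- from above. Both bounds are chord slopes of `f` tending to the Rankine-Hugoniot speed.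
    refine tendsto_of_tendsto_of_tendsto_of_le_of_le' lim1 lim2 ?_ ?_
    · filter_upwards [hnear, (l4.sub l3).eventually_const_lt (sub_pos.mpr hρ)] with s hs hpos
      have key := h.linearized_le ht hs.2.1 (h.isHopfLaxMin_yMinus (X t) ht)
        (h.isHopfLaxMin_yPlus (X s) hs.2.1)
      rw [slope_def_field]
      refine (div_le_div_iff₀ hpos (by linarith [hs.1])).mpr ?_
      simp only [Function.comp_apply]
      linarith
    · filter_upwards [hnear, (l1.sub l2).eventually_const_lt (sub_pos.mpr hρ)] with s hs hpos
      have key := h.linearized_le ht hs.2.1 (h.isHopfLaxMin_yPlus (X t) ht)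
        (h.isHopfLaxMin_yMinus (X s) hs.2.1)
      rw [slope_def_field]
      refine (div_le_div_iff₀ (by linarith [hs.1]) hpos).mpr ?_
      simp only [Function.comp_apply]
      linarith

end HopfLaxSetting

/-! ### Stieltjes signed measures of compactly supported functions -/

theorem StieltjesFunction.measure_of_constant_outside (S : StieltjesFunction ℝ) {R : ℝ}
    (hl : ∀ x, x ≤ -R → S x = S (-R)) (hr : ∀ x, R ≤ x → S x = S R) :
    S.measure univ = ENNReal.ofReal (S R - S (-R)) ∧ S.measure (Iic (-R)) = 0 ∧
      S.measure (Ioi R) = 0 := by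
  have hb : Tendsto S atBot (𝓝 (S (-R))) :=
    tendsto_const_nhds.congr' ((eventually_le_atBot (-R)).mono fun x hx => (hl x hx).symm)
  have ht : Tendsto S atTop (𝓝 (S R)) :=
    tendsto_const_nhds.congr' ((eventually_ge_atTop R).mono fun x hx => (hr x hx).symm)
  refine ⟨S.measure_univ hb ht, ?_, ?_⟩
  · rw [S.measure_Iic hb]; simp
  · rw [S.measure_Ioi ht]; simp

/-- A function vanishing outside `(-R, R)` whose increments on `[-R, R]` are dominated by those of
a monotone right-continuous function has a Stieltjes measure. -/
theorem exists_isStieltjesMeasure {F G : ℝ → ℝ} {R : ℝ} (hR : 0 ≤ R) (hG : Monotone G)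
    (hGc : ∀ x, ContinuousWithinAt G (Ici x) x) (hFl : ∀ x, x ≤ -R → F x = 0)
    (hFr : ∀ x, R ≤ x → F x = 0)
    (hFG : ∀ a b, -R ≤ a → a ≤ b → b ≤ R → |F b - F a| ≤ G b - G a) :
    ∃ μ : SignedMeasure ℝ, IsStieltjesMeasure F μ ∧ IsFiniteMeasure μ.variation ∧
      μ.variation.real univ ≤ 2 * (G R - G (-R)) ∧ ∀ᵐ x ∂μ.variation, x ∈ Ioc (-R) R := by
  -- Clamping to `[-R, R]` freezes `G` outside the interval, so that the measures below are finite
  -- and carry no mass there.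
  set p : ℝ → ℝ := fun x => max (-R) (min x R) with hp
  have hpm : Monotone p := fun a b hab => max_le_max le_rfl (min_le_min_right R hab)
  have hpc : Continuous p := by fun_prop
  have hpl : ∀ x, -R ≤ p x := fun x => le_max_left _ _
  have hpr : ∀ x, p x ≤ R := fun x => max_le (by linarith) (min_le_right _ _)
  have hpbot : ∀ x, x ≤ -R → p x = -R := fun x hx =>
    max_eq_left ((min_le_left _ _).trans hx)
  have hptop : ∀ x, R ≤ x → p x = R := fun x hx => by
    simp only [hp]; rw [min_eq_right hx, max_eq_right (by linarith)]
  have hFp : ∀ x, F (p x) = F x := by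
    intro x
    rcases le_total x (-R) with hx | hx
    · rw [hpbot x hx, hFl x hx, hFl _ le_rfl]
    rcases le_total x R with hx' | hx'
    · simp only [hp]; rw [min_eq_left hx', max_eq_right hx]
    · rw [hptop x hx', hFr x hx', hFr _ le_rfl]
  have hcG : ∀ x, ContinuousWithinAt (fun x => G (p x)) (Ici x) x := fun x =>
    (hGc (p x)).comp hpc.continuousWithinAt fun y hy => hpm hy
  have hcF : ∀ x, ContinuousWithinAt F (Ici x) x := by
    intro x
    have h0 : Tendsto (fun y => G (p y) - G (p x)) (𝓝[≥] x) (𝓝 0) := by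
      simpa using (hcG x).tendsto.sub_const (G (p x))
    refine tendsto_iff_norm_sub_tendsto_zero.mpr
      (squeeze_zero' (Eventually.of_forall fun _ => norm_nonneg _) ?_ h0)
    filter_upwards [self_mem_nhdsWithin] with y hy
    rw [← hFp y, ← hFp x, Real.norm_eq_abs]
    exact hFG _ _ (hpl x) (hpm hy) (hpr y)
  -- Jordan-type splitting `F = G∘p - (G∘p - F)`; domination of the increments makes the second
  -- function nondecreasing.
  let S₁ : StieltjesFunction ℝ := ⟨fun x => G (p x), fun a b hab => hG (hpm hab), hcG⟩
  let S₂ : StieltjesFunction ℝ := ⟨fun x => G (p x) - F x, fun a b hab => by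
    have := (abs_le.mp (hFG _ _ (hpl a) (hpm hab) (hpr b))).2
    rw [hFp, hFp] at this
    change G (p a) - F a ≤ G (p b) - F b
    linarith, fun x => (hcG x).sub (hcF x)⟩
  obtain ⟨m1, m1l, m1r⟩ := S₁.measure_of_constant_outside (R := R)
    (fun x hx => by change G (p x) = G (p (-R)); rw [hpbot x hx, hpbot _ le_rfl])
    (fun x hx => by change G (p x) = G (p R); rw [hptop x hx, hptop _ le_rfl])
  obtain ⟨m2, m2l, m2r⟩ := S₂.measure_of_constant_outside (R := R)
    (fun x hx => by
      change G (p x) - F x = G (p (-R)) - F (-R)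
      rw [hpbot x hx, hpbot _ le_rfl, hFl x hx, hFl _ le_rfl])
    (fun x hx => by
      change G (p x) - F x = G (p R) - F R
      rw [hptop x hx, hptop _ le_rfl, hFr x hx, hFr _ le_rfl])
  have e1 : S₁ R - S₁ (-R) = G R - G (-R) := by
    change G (p R) - G (p (-R)) = _
    rw [hptop _ le_rfl, hpbot _ le_rfl]
  have e2 : S₂ R - S₂ (-R) = G R - G (-R) := by
    change G (p R) - F R - (G (p (-R)) - F (-R)) = _
    rw [hptop _ le_rfl, hpbot _ le_rfl, hFl _ le_rfl, hFr _ le_rfl]; ring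
  rw [e1] at m1
  rw [e2] at m2
  have : IsFiniteMeasure S₁.measure := ⟨by rw [m1]; exact ENNReal.ofReal_lt_top⟩
  have : IsFiniteMeasure S₂.measure := ⟨by rw [m2]; exact ENNReal.ofReal_lt_top⟩
  set μ : SignedMeasure ℝ := S₁.measure.toSignedMeasure - S₂.measure.toSignedMeasure with hμ
  have happ : ∀ s, MeasurableSet s → μ s = S₁.measure.real s - S₂.measure.real s := by
    intro s hs
    rw [hμ, sub_apply, Measure.toSignedMeasure_apply_measurable hs,
      Measure.toSignedMeasure_apply_measurable hs]
  have hvar : μ.variation ≤ S₁.measure + S₂.measure := by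
    refine VectorMeasure.variation_le_of_forall_enorm_le fun s hs => ?_
    rw [happ s hs, Measure.add_apply]
    refine (enorm_sub_le).trans (add_le_add ?_ ?_) <;>
    · rw [Real.enorm_of_nonneg measureReal_nonneg, ofReal_measureReal]
  refine ⟨μ, fun a b hab => ?_, isFiniteMeasure_of_le _ hvar, ?_, ?_⟩
  · rw [happ _ measurableSet_Ioc, measureReal_def, measureReal_def, S₁.measure_Ioc, S₂.measure_Ioc,
      ENNReal.toReal_ofReal (sub_nonneg.mpr (S₁.mono hab)),
      ENNReal.toReal_ofReal (sub_nonneg.mpr (S₂.mono hab))]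
    change G (p b) - G (p a) - (G (p b) - F b - (G (p a) - F a)) = _
    ring
  · have hnn : 0 ≤ G R - G (-R) := sub_nonneg.mpr (hG (by linarith))
    rw [measureReal_def]
    refine ENNReal.toReal_le_of_le_ofReal (by linarith) ((hvar univ).trans_eq ?_)
    rw [Measure.add_apply, m1, m2, ← ENNReal.ofReal_add hnn hnn, two_mul]
  · refine ae_iff.mpr (measure_mono_null (t := Iic (-R) ∪ Ioi R) ?_ (measure_union_null ?_ ?_))
    · intro x (hx : ¬ (-R < x ∧ x ≤ R))
      rcases le_or_gt x (-R) with h' | h'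
      · exact Or.inl h'
      · exact Or.inr (by by_contra hc; exact hx ⟨h', not_lt.mp hc⟩)
    · refine le_antisymm ((hvar _).trans_eq ?_) zero_le
      rw [Measure.add_apply, m1l, m2l, add_zero]
    · refine le_antisymm ((hvar _).trans_eq ?_) zero_le
      rw [Measure.add_apply, m1r, m2r, add_zero]

/-- The step function equal to `0` on `(-∞, X)`, to `θ` at `X` and to `1` on `(X, ∞)`. -/
noncomputable def jumpStep (X θ x : ℝ) : ℝ :=
  (Ioi X).indicator (fun _ => 1) x + ({X} : Set ℝ).indicator (fun _ => θ) x

theorem measurable_jumpStep (X θ : ℝ) : Measurable (jumpStep X θ) :=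
  (measurable_const.indicator measurableSet_Ioi).add
    (measurable_const.indicator (measurableSet_singleton X))

theorem jumpStep_of_lt {X θ x : ℝ} (hx : X < x) : jumpStep X θ x = 1 := by
  simp [jumpStep, hx, hx.ne']

theorem jumpStep_of_gt {X θ x : ℝ} (hx : x < X) : jumpStep X θ x = 0 := by
  simp [jumpStep, hx.le, hx.ne]

theorem jumpStep_self (X θ : ℝ) : jumpStep X θ X = θ := by
  simp [jumpStep]

theorem jumpStep_mem_Icc {X θ : ℝ} (hθ : θ ∈ Icc (0 : ℝ) 1) (x : ℝ) :
    jumpStep X θ x ∈ Icc (0 : ℝ) 1 := by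
  rcases lt_trichotomy x X with hx | rfl | hx
  · rw [jumpStep_of_gt hx]; simp
  · rw [jumpStep_self]; exact hθ
  · rw [jumpStep_of_lt hx]; simp

theorem IsStieltjesMeasure.measure_Ioi {F : ℝ → ℝ} {μ : SignedMeasure ℝ} {R : ℝ}
    (h : IsStieltjesMeasure F μ) (hFr : ∀ x, R ≤ x → F x = 0) (X : ℝ) : μ (Ioi X) = -F X := by
  have hU : (⋃ n : ℕ, Ioc X (X + n)) = Ioi X := by
    ext y
    simp only [mem_iUnion, mem_Ioc, mem_Ioi]
    refine ⟨fun ⟨n, hn⟩ => hn.1, fun hy => ?_⟩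
    obtain ⟨n, hn⟩ := exists_nat_ge (y - X)
    exact ⟨n, hy, by linarith⟩
  have h1 : Tendsto (fun n : ℕ => μ (Ioc X (X + n))) atTop (𝓝 (μ (Ioi X))) := by
    rw [← hU]
    refine VectorMeasure.tendsto_vectorMeasure_iUnion_atTop_nat (fun m n hmn => ?_)
      fun _ => measurableSet_Ioc
    exact Ioc_subset_Ioc_right (by gcongr)
  refine tendsto_nhds_unique h1 (tendsto_const_nhds.congr' ?_)
  obtain ⟨N, hN⟩ := exists_nat_ge (R - X)
  filter_upwards [eventually_ge_atTop N] with n hn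
  have hn' : (N : ℝ) ≤ n := by exact_mod_cast hn
  rw [h _ _ (by linarith [Nat.cast_nonneg (α := ℝ) n]), hFr (X + n) (by linarith)]
  ring

theorem IsStieltjesMeasure.measure_singleton {F : ℝ → ℝ} {μ : SignedMeasure ℝ} {X L : ℝ}
    (h : IsStieltjesMeasure F μ) (hL : Tendsto F (𝓝[<] X) (𝓝 L)) : μ {X} = F X - L := by
  obtain ⟨u, hu, hux, hlim⟩ := exists_seq_strictMono_tendsto X
  have hI : (⋂ n : ℕ, Ioc (u n) X) = {X} := by
    ext y
    simp only [mem_iInter, mem_Ioc, mem_singleton_iff]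
    refine ⟨fun hy => le_antisymm (hy 0).2 (le_of_tendsto' hlim fun n => (hy n).1.le), ?_⟩
    rintro rfl
    exact fun n => ⟨hux n, le_rfl⟩
  have h1 : Tendsto (fun n : ℕ => μ (Ioc (u n) X)) atTop (𝓝 (μ {X})) := by
    rw [← hI]
    exact VectorMeasure.tendsto_vectorMeasure_iInter_atTop_nat
      (fun m n hmn => Ioc_subset_Ioc_left (hu.monotone hmn)) fun _ => measurableSet_Ioc
  have h2 : Tendsto (fun n => F X - F (u n)) atTop (𝓝 (F X - L)) :=
    (hL.comp (tendsto_nhdsWithin_iff.mpr ⟨hlim, Eventually.of_forall hux⟩)).const_sub _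
  exact tendsto_nhds_unique h1 (h2.congr fun n => (h _ _ (hux n).le).symm)

/-- The singleton `{X}` has mass `F X - L`, so the value of the step at its jump matters. This is
how the shock weight enters the flux. -/
theorem IsStieltjesMeasure.integral_jumpStep {F : ℝ → ℝ} {μ : SignedMeasure ℝ} {R X L : ℝ} (θ : ℝ)
    [IsFiniteMeasure μ.variation] (h : IsStieltjesMeasure F μ) (hFr : ∀ x, R ≤ x → F x = 0)
    (hL : Tendsto F (𝓝[<] X) (𝓝 L)) :
    ∫ᵛ x, jumpStep X θ x ∂•μ = -F X + θ * (F X - L) := by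
  unfold jumpStep
  rw [VectorMeasure.integral_fun_add, VectorMeasure.integral_indicator measurableSet_Ioi,
    VectorMeasure.integral_indicator (measurableSet_singleton X), VectorMeasure.setIntegral_const,
    VectorMeasure.setIntegral_const, h.measure_Ioi hFr, h.measure_singleton hL]
  · simp
  · exact (integrable_const _).indicator measurableSet_Ioi
  · exact (integrable_const _).indicator (measurableSet_singleton X)

/-! ### Test functions -/

/-- A test function on the plane with support in the open square of half-side `R` and
values and derivatives bounded by `K`. -/
structure IsTestFunction (φ : ℝ × ℝ → ℝ) (R K : ℝ) : Prop where
  smooth : ContDiff ℝ 1 φ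
  pos : 0 < R
  nonneg : 0 ≤ K
  zero : ∀ x t, R ≤ |x| ∨ R ≤ |t| → φ (x, t) = 0
  fderiv_zero : ∀ x t, R ≤ |x| ∨ R ≤ |t| → fderiv ℝ φ (x, t) = 0
  bound : ∀ p, ‖φ p‖ ≤ K
  fderiv_bound : ∀ p, ‖fderiv ℝ φ p‖ ≤ K

theorem exists_isTestFunction {φ : ℝ × ℝ → ℝ} (hφ : ContDiff ℝ ∞ φ) (hc : HasCompactSupport φ) :
    ∃ R K, IsTestFunction φ R K := by
  have h1 : ContDiff ℝ 1 φ := hφ.of_le (by exact_mod_cast le_top)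
  obtain ⟨K₁, hK₁⟩ := h1.continuous.bounded_above_of_compact_support hc
  obtain ⟨K₂, hK₂⟩ :=
    (h1.continuous_fderiv one_ne_zero).bounded_above_of_compact_support (hc.fderiv (𝕜 := ℝ))
  obtain ⟨R, hR⟩ := hc.isCompact.isBounded.subset_ball (0 : ℝ × ℝ)
  have hout : ∀ x t : ℝ, max R 1 ≤ |x| ∨ max R 1 ≤ |t| → (x, t) ∉ tsupport φ := by
    intro x t hxt hmem
    have := mem_ball_zero_iff.mp (hR hmem)
    rw [Prod.norm_def, max_lt_iff, Real.norm_eq_abs, Real.norm_eq_abs] at this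
    rcases hxt with h | h
    · exact absurd ((le_max_left R 1).trans h) (not_le.mpr this.1)
    · exact absurd ((le_max_left R 1).trans h) (not_le.mpr this.2)
  refine ⟨max R 1, max K₁ K₂, h1, by positivity, (norm_nonneg _).trans
    ((hK₁ 0).trans (le_max_left _ _)), fun x t h => image_eq_zero_of_notMem_tsupport (hout x t h),
    fun x t h => ?_, fun p => (hK₁ p).trans (le_max_left _ _),
    fun p => (hK₂ p).trans (le_max_right _ _)⟩
  by_contra hne
  exact hout x t h (support_fderiv_subset ℝ hne)

namespace IsTestFunction

variable {φ : ℝ × ℝ → ℝ} {R K : ℝ}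

theorem hasFDerivAt (h : IsTestFunction φ R K) (p : ℝ × ℝ) :
    HasFDerivAt φ (fderiv ℝ φ p) p :=
  (h.smooth.differentiable one_ne_zero p).hasFDerivAt

theorem timeDeriv_eq (h : IsTestFunction φ R K) (x t : ℝ) :
    timeDeriv φ x t = fderiv ℝ φ (x, t) (0, 1) := by
  have h1 : HasDerivAt (fun s : ℝ => (x, s)) ((0, 1) : ℝ × ℝ) t :=
    (hasDerivAt_const t x).prodMk (hasDerivAt_id t)
  exact ((h.hasFDerivAt (x, t)).comp_hasDerivAt t h1).deriv

theorem hasDerivAt_left (h : IsTestFunction φ R K) (x t : ℝ) :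
    HasDerivAt (fun y => φ (y, t)) (fderiv ℝ φ (x, t) (1, 0)) x :=
  (h.hasFDerivAt (x, t)).comp_hasDerivAt (f := fun y : ℝ => (y, t)) x
    ((hasDerivAt_id x).prodMk (hasDerivAt_const x t))

theorem continuous_fderiv (h : IsTestFunction φ R K) : Continuous (fderiv ℝ φ) :=
  h.smooth.continuous_fderiv one_ne_zero

theorem continuous_timeDeriv (h : IsTestFunction φ R K) :
    Continuous fun p : ℝ × ℝ => timeDeriv φ p.1 p.2 := by
  simp_rw [h.timeDeriv_eq]
  exact h.continuous_fderiv.clm_apply continuous_const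

theorem timeDeriv_zero (h : IsTestFunction φ R K) {x t : ℝ} (hxt : R ≤ |x| ∨ R ≤ |t|) :
    timeDeriv φ x t = 0 := by
  rw [h.timeDeriv_eq, h.fderiv_zero x t hxt]; rfl

theorem fderiv_apply_le (h : IsTestFunction φ R K) (p v : ℝ × ℝ) (hv : ‖v‖ ≤ 1) :
    |fderiv ℝ φ p v| ≤ K := by
  have := (fderiv ℝ φ p).le_opNorm v
  rw [Real.norm_eq_abs] at this
  exact this.trans ((mul_le_mul (h.fderiv_bound p) hv (norm_nonneg _) h.nonneg).trans_eq
    (mul_one K))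

theorem timeDeriv_le (h : IsTestFunction φ R K) (x t : ℝ) : |timeDeriv φ x t| ≤ K := by
  rw [h.timeDeriv_eq]
  exact h.fderiv_apply_le _ _ (by simp [Prod.norm_def])

theorem abs_sub_le (h : IsTestFunction φ R K) (t : ℝ) {a b : ℝ} (hab : a ≤ b) :
    |φ (b, t) - φ (a, t)| ≤ K * (b - a) := by
  have := Convex.norm_image_sub_le_of_norm_hasDerivWithin_le (s := univ) (C := K)
    (fun x _ => (h.hasDerivAt_left x t).hasDerivWithinAt)
    (fun x _ => h.fderiv_apply_le (x, t) (1, 0) (by simp [Prod.norm_def])) convex_univ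
    (mem_univ a) (mem_univ b)
  rwa [Real.norm_eq_abs, Real.norm_eq_abs, abs_of_nonneg (by linarith : 0 ≤ b - a)] at this

theorem continuous (h : IsTestFunction φ R K) : Continuous φ := h.smooth.continuous

/-- A continuous function vanishing outside `(-R, R)` is integrable. -/
theorem integrable_of_zero {g : ℝ → ℝ} {R : ℝ} (hg : Continuous g)
    (h0 : ∀ x, R ≤ |x| → g x = 0) : Integrable g :=
  hg.integrable_of_hasCompactSupport (HasCompactSupport.intro (isCompact_Icc (a := -R) (b := R))
    fun x hx => h0 x (by
      by_contra! hlt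
      exact hx ⟨(abs_lt.mp hlt).1.le, (abs_lt.mp hlt).2.le⟩))

theorem integrable_slice (h : IsTestFunction φ R K) (t : ℝ) :
    Integrable fun x => φ (x, t) :=
  integrable_of_zero (h.continuous.comp (by fun_prop)) fun x hx => h.zero x t (Or.inl hx)

theorem integrable_timeDeriv (h : IsTestFunction φ R K) (t : ℝ) :
    Integrable fun x => timeDeriv φ x t :=
  integrable_of_zero (h.continuous_timeDeriv.comp (f := fun x : ℝ => (x, t)) (by fun_prop))
    fun x hx => h.timeDeriv_zero (Or.inl hx)

theorem setIntegral_Ioi_eq_shift (g : ℝ → ℝ) (X : ℝ) :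
    ∫ x in Ioi X, g x = ∫ r in Ioi (0 : ℝ), g (X + r) := by
  have := (measurePreserving_add_left volume X).setIntegral_preimage_emb
    (measurableEmbedding_addLeft X) g (Ioi X)
  rw [← this]
  congr 2
  ext r
  simp

/-- Shifting the variable fixes the domain at `(0, ∞)`, so the moving endpoint becomes a smooth
parameter and differentiation under the integral applies. -/
theorem hasFDerivAt_tail (h : IsTestFunction φ R K) (p : ℝ × ℝ) :
    HasFDerivAt (fun p : ℝ × ℝ => ∫ r in Ioi (0 : ℝ), φ (p + (r, 0)))
      (∫ r in Ioi (0 : ℝ), fderiv ℝ φ (p + (r, 0))) p := by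
  have hshift : Continuous fun r : ℝ => ((r, 0) : ℝ × ℝ) := by fun_prop
  have hcont : ∀ q : ℝ × ℝ, Continuous fun r : ℝ => φ (q + (r, 0)) := fun q =>
    h.continuous.comp (continuous_const.add hshift)
  have hcont' : Continuous fun r : ℝ => fderiv ℝ φ (p + (r, 0)) :=
    h.continuous_fderiv.comp (continuous_const.add hshift)
  -- Beyond `M`, every shift of a point within distance `1` of `p` has left the support.
  set M := R + |p.1| + 1
  have hbig : ∀ q ∈ Metric.ball p 1, ∀ r, M < r → R ≤ |(q + (r, 0)).1| := by
    intro q hq r hr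
    have h1 : |q.1 - p.1| < 1 := by
      have := (le_max_left (dist q.1 p.1) (dist q.2 p.2)).trans_lt (Metric.mem_ball.mp hq)
      rwa [Real.dist_eq] at this
    have h2 := (abs_lt.mp h1).1
    have h3 := neg_abs_le p.1
    refine le_trans ?_ (le_abs_self _)
    change R ≤ q.1 + r
    have : R + |p.1| + 1 < r := hr
    linarith
  refine hasFDerivAt_integral_of_dominated_of_fderiv_le
    (F' := fun q r => fderiv ℝ φ (q + (r, 0))) (bound := (Iic M).indicator fun _ => K)
    (Metric.ball_mem_nhds p one_pos)
    (Eventually.of_forall fun q => (hcont q).aestronglyMeasurable) ?_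
    hcont'.aestronglyMeasurable ?_ ?_ ?_
  · refine Integrable.integrableOn ?_
    refine integrable_of_zero (R := R + |p.1|) (hcont p) fun r hr => h.zero _ _ (Or.inl ?_)
    have := abs_sub_abs_le_abs_sub r (-p.1)
    rw [abs_neg, sub_neg_eq_add, add_comm r] at this
    linarith
  · refine Eventually.of_forall fun r q hq => ?_
    by_cases hr : r ≤ M
    · rw [indicator_of_mem (show r ∈ Iic M from hr)]; exact h.fderiv_bound _
    · rw [indicator_of_notMem (show r ∉ Iic M from hr)]
      have := h.fderiv_zero _ (q + (r, 0)).2 (Or.inl (hbig q hq r (not_le.mp hr)))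
      rw [Prod.mk.eta] at this
      rw [this, norm_zero]
  · rw [integrable_indicator_iff measurableSet_Iic]
    refine integrableOn_const ?_
    rw [Measure.restrict_apply measurableSet_Iic, inter_comm, Ioi_inter_Iic]
    exact measure_Ioc_lt_top.ne
  · exact Eventually.of_forall fun r q _ => 
      (hasFDerivAt_comp_add_right (r, 0)).mpr (h.hasFDerivAt (q + (r, 0)))

theorem integrable_shift_fderiv (h : IsTestFunction φ R K) (x t : ℝ) :
    Integrable fun r : ℝ => fderiv ℝ φ ((x, t) + (r, 0)) := by
  have hc : Continuous fun r : ℝ => fderiv ℝ φ ((x, t) + (r, 0)) :=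
    h.continuous_fderiv.comp (by fun_prop)
  refine hc.integrable_of_hasCompactSupport (HasCompactSupport.intro
    (isCompact_Icc (a := -R - x) (b := R - x)) fun r hr => h.fderiv_zero _ _ (Or.inl ?_))
  by_contra! hlt
  have := abs_lt.mp hlt
  exact hr ⟨by linarith, by linarith⟩

/-- Leibniz rule for the integral of a test function to the right of a moving point. -/
theorem hasDerivWithinAt_tail (h : IsTestFunction φ R K) {X : ℝ → ℝ} {σ t : ℝ} {s : Set ℝ}
    (hX : HasDerivWithinAt X σ s t) :
    HasDerivWithinAt (fun t => ∫ x in Ioi (X t), φ (x, t))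
      ((∫ x in Ioi (X t), timeDeriv φ x t) - φ (X t, t) * σ) s t := by
  have e1 : (fun t => ∫ x in Ioi (X t), φ (x, t)) =
      (fun p : ℝ × ℝ => ∫ r in Ioi (0 : ℝ), φ (p + (r, 0))) ∘ fun t => (X t, t) := by
    funext t
    rw [setIntegral_Ioi_eq_shift]
    simp
  have h1 := (h.hasFDerivAt_tail (X t, t)).comp_hasDerivWithinAt (f := fun t => (X t, t)) t
    (hX.prodMk (hasDerivWithinAt_id t s))
  rw [e1]
  refine h1.congr_deriv ?_
  have hint := (h.integrable_shift_fderiv (X t) t).integrableOn (s := Ioi 0)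
  rw [ContinuousLinearMap.integral_apply hint]
  have hx := hint.apply_continuousLinearMap (1, 0)
  have ht := hint.apply_continuousLinearMap (0, 1)
  have e2 : ∀ r : ℝ, fderiv ℝ φ ((X t, t) + (r, 0)) (σ, 1) =
      σ * fderiv ℝ φ ((X t, t) + (r, 0)) (1, 0) + fderiv ℝ φ ((X t, t) + (r, 0)) (0, 1) := by
    intro r
    rw [← smul_eq_mul, ← map_smul, ← map_add]
    simp
  simp_rw [e2]
  rw [integral_add (hx.const_mul σ) ht, integral_const_mul]
  -- The horizontal derivative integrates to the boundary term at the moving endpoint.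
  have e3 : ∫ r in Ioi (0 : ℝ), fderiv ℝ φ ((X t, t) + (r, 0)) (1, 0) = 0 - φ (X t, t) := by
    have hd : ∀ r ∈ Ici (0 : ℝ), HasDerivAt (fun r => φ (X t + r, t))
        (fderiv ℝ φ ((X t, t) + (r, 0)) (1, 0)) r := by
      intro r _
      have := (h.hasDerivAt_left (X t + r) t).comp_const_add (X t) r
      simpa using this
    have hlim : Tendsto (fun r => φ (X t + r, t)) atTop (𝓝 0) := by
      refine tendsto_const_nhds.congr' ?_
      filter_upwards [eventually_ge_atTop (R - X t)] with r hr
      exact (h.zero _ _ (Or.inl (le_trans (by linarith) (le_abs_self _)))).symm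
    have := integral_Ioi_of_hasDerivAt_of_tendsto' hd hx hlim
    simpa using this
  rw [e3, setIntegral_Ioi_eq_shift (fun x => timeDeriv φ x t)]
  simp_rw [h.timeDeriv_eq]
  simp only [Prod.mk_add_mk, add_zero]
  ring

end IsTestFunction

/-! ### The measures `d[φ c]` and the transport equation for step functions along fronts -/

/-- A family of Stieltjes measures `d[φ(·,t) c(·,t)]`, supported in `(-R, R]`, vanishing for
`t ≥ R`, and of bounded total variation away from `t = 0`. -/
structure IsFluxMeasureFamily (c : ℝ → ℝ → ℝ) (φ : ℝ × ℝ → ℝ) (R : ℝ)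
    (μ : ℝ → SignedMeasure ℝ) : Prop where
  stieltjes : ∀ t, 0 < t → IsStieltjesMeasure (fun x => φ (x, t) * c x t) (μ t)
  finite : ∀ t, IsFiniteMeasure (μ t).variation
  supp : ∀ t, ∀ᵐ x ∂(μ t).variation, x ∈ Ioc (-R) R
  zero : ∀ t, R ≤ t → μ t = 0
  bound : ∀ ε, 0 < ε → ∃ C, ∀ t, ε ≤ t → (μ t).variation.real univ ≤ C

/-- `w` satisfies the weak transport equation, tested with `φ`, from the initial time `ε` on. -/
structure SolvesFrom (φ : ℝ × ℝ → ℝ) (μ : ℝ → SignedMeasure ℝ) (ε : ℝ) (w : ℝ → ℝ → ℝ) :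
    Prop where
  meas : ∀ t, Measurable fun x => w x t
  bdd : ∃ C, ∀ x t, ε ≤ t → |w x t| ≤ C
  integrable_time : IntegrableOn (fun t => ∫ x, timeDeriv φ x t * w x t) (Ioi ε)
  integrable_flux : IntegrableOn (fun t => ∫ᵛ x, w x t ∂•(μ t)) (Ioi ε)
  eq_zero : (∫ t in Ioi ε, ∫ x, timeDeriv φ x t * w x t) + (∫ t in Ioi ε, ∫ᵛ x, w x t ∂•(μ t)) +
    ∫ x, w x ε * φ (x, ε) = 0

/-- A multiple of an integrable function by a bounded measurable function is integrable. -/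
theorem integrable_mul_of_bounded {α : Type*} [MeasurableSpace α] {m : Measure α} {g w : α → ℝ}
    {C : ℝ} (hg : Integrable g m) (hw : AEStronglyMeasurable w m) (hC : ∀ᵐ x ∂m, |w x| ≤ C) :
    Integrable (fun x => g x * w x) m :=
  hg.mul_bdd hw hC

theorem SignedMeasure.integrable_of_bounded {α : Type*} [MeasurableSpace α] {μ : SignedMeasure α}
    [IsFiniteMeasure μ.variation] {w : α → ℝ} {C : ℝ} (hw : Measurable w)
    (hC : ∀ᵐ x ∂μ.variation, |w x| ≤ C) : μ.Integrable w :=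
  Integrable.of_bound hw.aestronglyMeasurable C hC

/-! ### Linear combinations of solutions -/

namespace SolvesFrom

variable {φ : ℝ × ℝ → ℝ} {R K ε : ℝ} {μ : ℝ → SignedMeasure ℝ} {c w w' : ℝ → ℝ → ℝ}

theorem zero : SolvesFrom φ μ ε fun _ _ => 0 where
  meas _ := measurable_const
  bdd := ⟨0, fun _ _ _ => by simp⟩
  integrable_time := by simp
  integrable_flux := by simp
  eq_zero := by simp

theorem const_mul (hw : SolvesFrom φ μ ε w) (b : ℝ) :
    SolvesFrom φ μ ε fun x t => b * w x t := by
  have e1 : ∀ t, ∫ x, timeDeriv φ x t * (b * w x t) = b * ∫ x, timeDeriv φ x t * w x t := by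
    intro t
    rw [← integral_const_mul]
    congr 1 with x
    ring
  have e2 : ∀ t, ∫ᵛ x, b * w x t ∂•(μ t) = b * ∫ᵛ x, w x t ∂•(μ t) := fun t => by
    simpa using VectorMeasure.integral_fun_smul (μ t) (ContinuousLinearMap.lsmul ℝ ℝ) b
      (fun x => w x t)
  obtain ⟨C, hC⟩ := hw.bdd
  refine ⟨fun t => (hw.meas t).const_mul b, ⟨|b| * C, fun x t ht => ?_⟩, ?_, ?_, ?_⟩
  · rw [abs_mul]; exact mul_le_mul_of_nonneg_left (hC x t ht) (abs_nonneg b)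
  · simp_rw [e1]; exact hw.integrable_time.const_mul b
  · simp_rw [e2]; exact hw.integrable_flux.const_mul b
  · simp_rw [e1, e2, mul_assoc]
    rw [integral_const_mul, integral_const_mul, integral_const_mul, ← mul_add, ← mul_add,
      hw.eq_zero, mul_zero]

theorem add (hφ : IsTestFunction φ R K) (hμ : IsFluxMeasureFamily c φ R μ)
    (hw : SolvesFrom φ μ ε w) (hw' : SolvesFrom φ μ ε w') :
    SolvesFrom φ μ ε fun x t => w x t + w' x t := by
  obtain ⟨C, hC⟩ := hw.bdd
  obtain ⟨C', hC'⟩ := hw'.bdd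
  have key1 : ∀ {v : ℝ → ℝ → ℝ}, SolvesFrom φ μ ε v → ∀ {t}, ε ≤ t →
      Integrable fun x => timeDeriv φ x t * v x t := fun hv t ht =>
    let ⟨C, hC⟩ := hv.bdd
    integrable_mul_of_bounded (hφ.integrable_timeDeriv t) (hv.meas t).aestronglyMeasurable
      (Eventually.of_forall fun x => hC x t ht)
  have key2 : ∀ {v : ℝ → ℝ → ℝ}, SolvesFrom φ μ ε v → ∀ {t}, ε ≤ t →
      (μ t).Integrable fun x => v x t := fun hv t ht =>
    let ⟨C, hC⟩ := hv.bdd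
    have := hμ.finite t
    SignedMeasure.integrable_of_bounded (hv.meas t) (Eventually.of_forall fun x => hC x t ht)
  have key3 : ∀ {v : ℝ → ℝ → ℝ}, SolvesFrom φ μ ε v → Integrable fun x => v x ε * φ (x, ε) :=
    fun hv =>
    let ⟨C, hC⟩ := hv.bdd
    (integrable_mul_of_bounded (hφ.integrable_slice ε) (hv.meas ε).aestronglyMeasurable
      (Eventually.of_forall fun x => hC x ε le_rfl)).congr
        (Eventually.of_forall fun x => mul_comm _ _)
  have e1 : EqOn (fun t => ∫ x, timeDeriv φ x t * (w x t + w' x t))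
      (fun t => (∫ x, timeDeriv φ x t * w x t) + ∫ x, timeDeriv φ x t * w' x t) (Ioi ε) := by
    intro t ht
    simp only [mul_add]
    exact integral_add (key1 hw (le_of_lt ht)) (key1 hw' (le_of_lt ht))
  have e2 : EqOn (fun t => ∫ᵛ x, w x t + w' x t ∂•(μ t))
      (fun t => (∫ᵛ x, w x t ∂•(μ t)) + ∫ᵛ x, w' x t ∂•(μ t)) (Ioi ε) := fun t ht =>
    VectorMeasure.integral_fun_add (key2 hw (le_of_lt ht)) (key2 hw' (le_of_lt ht))
  refine ⟨fun t => (hw.meas t).add (hw'.meas t), ⟨C + C', fun x t ht => ?_⟩, ?_, ?_, ?_⟩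
  · exact (abs_add_le _ _).trans (add_le_add (hC x t ht) (hC' x t ht))
  · exact (integrableOn_congr_fun e1 measurableSet_Ioi).mpr
      (hw.integrable_time.add hw'.integrable_time)
  · exact (integrableOn_congr_fun e2 measurableSet_Ioi).mpr
      (hw.integrable_flux.add hw'.integrable_flux)
  · rw [setIntegral_congr_fun measurableSet_Ioi e1, setIntegral_congr_fun measurableSet_Ioi e2,
      integral_add hw.integrable_time hw'.integrable_time,
      integral_add hw.integrable_flux hw'.integrable_flux]
    simp only [add_mul]
    rw [integral_add (key3 hw) (key3 hw')]
    linarith [hw.eq_zero, hw'.eq_zero]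

theorem sum (hφ : IsTestFunction φ R K) (hμ : IsFluxMeasureFamily c φ R μ)
    {w : ℕ → ℝ → ℝ → ℝ} (hw : ∀ i, SolvesFrom φ μ ε (w i)) (b : ℕ → ℝ) (n : ℕ) :
    SolvesFrom φ μ ε fun x t => ∑ i ∈ Finset.range n, b i * w i x t := by
  induction n with
  | zero => simpa using zero
  | succ n ih =>
    simp_rw [Finset.sum_range_succ]
    exact ih.add hφ hμ ((hw n).const_mul (b n))

end SolvesFrom

/-- The step function `1_{x > X(t)}` of the front `X` from `a`, with the shock weight on the
front. -/
noncomputable def frontStep (f u₀ : ℝ → ℝ) (a x t : ℝ) : ℝ :=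
  jumpStep (hopfLaxFront f u₀ a t)
    (shockWeight f (rhoPlus f u₀ (hopfLaxFront f u₀ a t) t)
      (rhoMinus f u₀ (hopfLaxFront f u₀ a t) t)) x

/-! ### Existence of the flux measures, and the equation for a single front -/

namespace HopfLaxSetting

variable {f u₀ : ℝ → ℝ} {φ : ℝ × ℝ → ℝ} {R K : ℝ}

theorem exists_yMinus_lower_bound (h : HopfLaxSetting f u₀) (hR : 0 < R) :
    ∃ A, ∀ x t, -R ≤ x → 0 < t → t ≤ R → A ≤ yMinus f u₀ x t :=
  let ⟨A, hA⟩ := h.exists_lower_bound (-R - 1) hR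
  ⟨A, fun x t hx ht htR => hA x t _ (by linarith) ht htR (h.isHopfLaxMin_yMinus x ht)⟩

/-- At fixed `t` the speed `f'(ρ⁺) = (x - y⁺) / t` is a difference of nondecreasing functions, hence
locally of bounded variation. The factor `1 / t` in the bound is the reason for working on `(ε, ∞)`
first. -/
theorem exists_isStieltjesMeasure_slice (h : HopfLaxSetting f u₀) (hφ : IsTestFunction φ R K)
    {A t : ℝ} (hA : ∀ x t, -R ≤ x → 0 < t → t ≤ R → A ≤ yMinus f u₀ x t) (ht : 0 < t)
    (htR : t ≤ R) :
    ∃ μ : SignedMeasure ℝ,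
      IsStieltjesMeasure (fun x => φ (x, t) * deriv f (rhoPlus f u₀ x t)) μ ∧
      IsFiniteMeasure μ.variation ∧
      μ.variation.real univ ≤ 2 * (K / t * ((1 + (R - A)) * (2 * R) + (R - A))) ∧
      ∀ᵐ x ∂μ.variation, x ∈ Ioc (-R) R := by
  have hR := hφ.pos
  have hK := hφ.nonneg
  have hAp : ∀ x, -R ≤ x → A ≤ yPlus f u₀ x t := fun x hx =>
    (hA x t hx ht htR).trans (h.yMinus_le_yPlus x ht)
  have hAR : A ≤ R := (hAp R (by linarith)).trans (h.yPlus_le R ht)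
  -- The summand `x + y⁺` dominates the increments of `x - y⁺`. The extra `(R - A) x` pays for the
  -- Lipschitz variation of `φ` multiplied by `x - y⁺ ≤ R - A`.
  set G : ℝ → ℝ := fun x => K / t * ((1 + (R - A)) * x + yPlus f u₀ x t) with hG
  have hKt : 0 ≤ K / t := div_nonneg hK ht.le
  have hGm : Monotone G := fun a b hab => mul_le_mul_of_nonneg_left
    (add_le_add (mul_le_mul_of_nonneg_left hab (by linarith)) (h.monotone_yPlus ht hab)) hKt
  have hGc : ∀ x, ContinuousWithinAt G (Ici x) x := by
    intro x
    refine continuousWithinAt_const.mul (ContinuousWithinAt.add (by fun_prop) ?_)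
    exact continuousWithinAt_Ioi_iff_Ici.mp (h.tendsto_yPlus_right x ht)
  have hFG : ∀ a b, -R ≤ a → a ≤ b → b ≤ R →
      |φ (b, t) * deriv f (rhoPlus f u₀ b t) - φ (a, t) * deriv f (rhoPlus f u₀ a t)| ≤
        G b - G a := by
    intro a b ha hab hb
    simp only [h.deriv_rhoPlus]
    have ey := h.monotone_yPlus ht hab
    have e1 : φ (b, t) * ((b - yPlus f u₀ b t) / t) - φ (a, t) * ((a - yPlus f u₀ a t) / t) =
        (φ (b, t) * ((b - a) - (yPlus f u₀ b t - yPlus f u₀ a t)) +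
          (φ (b, t) - φ (a, t)) * (a - yPlus f u₀ a t)) / t := by ring
    have e2 : G b - G a = (K * ((b - a) + (yPlus f u₀ b t - yPlus f u₀ a t)) +
        K * (b - a) * (R - A)) / t := by simp only [hG]; ring
    rw [e1, e2, abs_div, abs_of_pos ht]
    refine div_le_div_of_nonneg_right ((abs_add_le _ _).trans (add_le_add ?_ ?_)) ht.le
    · rw [abs_mul]
      refine mul_le_mul (hφ.bound (b, t)) ((abs_sub _ _).trans ?_) (abs_nonneg _) hK
      rw [abs_of_nonneg (by linarith), abs_of_nonneg (sub_nonneg.mpr ey)]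
    · rw [abs_mul]
      refine mul_le_mul (hφ.abs_sub_le t hab) ?_ (abs_nonneg _)
        (mul_nonneg hK (by linarith))
      have h1 := hAp a ha
      have h2 := h.yPlus_le a ht
      rw [abs_of_nonneg (by linarith)]
      linarith
  obtain ⟨μ, h1, h2, h3, h4⟩ := exists_isStieltjesMeasure
    (F := fun x => φ (x, t) * deriv f (rhoPlus f u₀ x t)) (G := G) hR.le hGm hGc
    (fun x hx => by
      rw [hφ.zero x t (Or.inl (le_trans (by linarith) (neg_le_abs x))), zero_mul])
    (fun x hx => by rw [hφ.zero x t (Or.inl (hx.trans (le_abs_self x))), zero_mul]) hFG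
  refine ⟨μ, h1, h2, h3.trans ?_, h4⟩
  have e : G R - G (-R) =
      K / t * ((1 + (R - A)) * (2 * R) + (yPlus f u₀ R t - yPlus f u₀ (-R) t)) := by
    simp only [hG]; ring
  rw [e]
  have := h.yPlus_le R ht
  have := hAp (-R) le_rfl
  have h5 := mul_le_mul_of_nonneg_left
    (show (1 + (R - A)) * (2 * R) + (yPlus f u₀ R t - yPlus f u₀ (-R) t) ≤
      (1 + (R - A)) * (2 * R) + (R - A) by linarith) hKt
  linarith

theorem exists_isFluxMeasureFamily (h : HopfLaxSetting f u₀) (hφ : IsTestFunction φ R K) :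
    ∃ μ, IsFluxMeasureFamily (fun x t => deriv f (rhoPlus f u₀ x t)) φ R μ := by
  classical
  obtain ⟨A, hA⟩ := h.exists_yMinus_lower_bound hφ.pos
  have hAR : A ≤ R := (hA R R (by linarith [hφ.pos]) hφ.pos le_rfl).trans
    ((h.isHopfLaxMin_yMinus R hφ.pos).le h hφ.pos)
  have hex := fun t (ht : 0 < t ∧ t < R) =>
    h.exists_isStieltjesMeasure_slice hφ hA ht.1 ht.2.le
  refine ⟨fun t => if ht : 0 < t ∧ t < R then (hex t ht).choose else 0, ?_, ?_, ?_, ?_, ?_⟩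
  · intro t ht
    by_cases htR : t < R
    · simp only [dif_pos (And.intro ht htR)]
      exact (hex t ⟨ht, htR⟩).choose_spec.1
    · simp only [dif_neg (fun hc : 0 < t ∧ t < R => htR hc.2)]
      intro a b _
      have hz : ∀ x, φ (x, t) = 0 := fun x =>
        hφ.zero x t (Or.inr ((not_lt.mp htR).trans (le_abs_self t)))
      simp [hz]
  · intro t
    by_cases ht : 0 < t ∧ t < R
    · simp only [dif_pos ht]; exact (hex t ht).choose_spec.2.1
    · simp only [dif_neg ht, VectorMeasure.variation_zero]; infer_instance
  · intro t
    by_cases ht : 0 < t ∧ t < R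
    · simp only [dif_pos ht]; exact (hex t ht).choose_spec.2.2.2
    · simp [dif_neg ht]
  · intro t ht
    exact dif_neg fun hc => absurd hc.2 (not_lt.mpr ht)
  · intro ε hε
    refine ⟨2 * (K / ε * ((1 + (R - A)) * (2 * R) + (R - A))), fun t hεt => ?_⟩
    have hpos : 0 ≤ (1 + (R - A)) * (2 * R) + (R - A) := by
      have := mul_nonneg (show 0 ≤ 1 + (R - A) by linarith)
        (show 0 ≤ 2 * R by linarith [hφ.pos])
      linarith
    by_cases ht : 0 < t ∧ t < R
    · simp only [dif_pos ht]
      refine (hex t ht).choose_spec.2.2.1.trans (mul_le_mul_of_nonneg_left ?_ two_pos.le)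
      exact mul_le_mul_of_nonneg_right (div_le_div_of_nonneg_left hφ.nonneg hε hεt) hpos
    · simp only [dif_neg ht, VectorMeasure.variation_zero]
      have := mul_nonneg (div_nonneg hφ.nonneg hε.le) hpos
      simpa using this

/-- Across the front the speed jumps from `(X - y⁻) / t` to `(X - y⁺) / t`; the half-line and the
weighted atom together average these two speeds into the front velocity. -/
theorem integral_frontStep (h : HopfLaxSetting f u₀) (hφ : IsTestFunction φ R K)
    {μ : ℝ → SignedMeasure ℝ}
    (hμ : IsFluxMeasureFamily (fun x t => deriv f (rhoPlus f u₀ x t)) φ R μ) (a : ℝ) {t : ℝ}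
    (ht : 0 < t) :
    ∫ᵛ x, frontStep f u₀ a x t ∂•(μ t) =
      -(φ (hopfLaxFront f u₀ a t, t) * meanSpeed f u₀ (hopfLaxFront f u₀ a t) t) := by
  have := hμ.finite t
  set X := hopfLaxFront f u₀ a t
  have hL : Tendsto (fun x => φ (x, t) * deriv f (rhoPlus f u₀ x t)) (𝓝[<] X)
      (𝓝 (φ (X, t) * ((X - yMinus f u₀ X t) / t))) := by
    simp only [h.deriv_rhoPlus]
    have hid : Tendsto (fun x : ℝ => x) (𝓝[<] X) (𝓝 X) := tendsto_id.mono_left nhdsWithin_le_nhds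
    refine Tendsto.mul ?_ ((hid.sub (h.tendsto_yPlus_left X ht)).div_const t)
    exact ((hφ.continuous.comp (f := fun x : ℝ => (x, t)) (by fun_prop)).tendsto X).mono_left
      nhdsWithin_le_nhds
  unfold frontStep
  rw [(hμ.stieltjes t ht).integral_jumpStep (R := R) _
    (fun x hx => by rw [hφ.zero x t (Or.inl (hx.trans (le_abs_self x))), zero_mul]) hL,
    h.deriv_rhoPlus, meanSpeed]
  ring

theorem integral_mul_frontStep (g : ℝ → ℝ) (a t : ℝ) :
    ∫ x, g x * frontStep f u₀ a x t = ∫ x in Ioi (hopfLaxFront f u₀ a t), g x := by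
  rw [← integral_indicator measurableSet_Ioi]
  refine integral_congr_ae ?_
  filter_upwards [Measure.ae_ne volume (hopfLaxFront f u₀ a t)] with x hx
  rcases lt_or_gt_of_ne hx with hlt | hlt
  · rw [frontStep, jumpStep_of_gt hlt, mul_zero, indicator_of_notMem (by simpa using hlt.le)]
  · rw [frontStep, jumpStep_of_lt hlt, mul_one, indicator_of_mem (mem_Ioi.mpr hlt)]

theorem meanSpeed_front_le (h : HopfLaxSetting f u₀) (a : ℝ) {ε T : ℝ} (hε : 0 < ε) :
    ∃ C, ∀ t, ε ≤ t → t ≤ T → |meanSpeed f u₀ (hopfLaxFront f u₀ a t) t| ≤ C := by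
  rcases lt_or_ge T ε with hT | hT
  · exact ⟨0, fun t h1 h2 => absurd (h1.trans h2) (not_le.mpr hT)⟩
  have hT0 : 0 < T := hε.trans_le hT
  obtain ⟨A, hA⟩ := h.exists_lower_bound_front a hT0
  refine ⟨(hopfLaxFront f u₀ a T - A) / ε, fun t h1 h2 => ?_⟩
  have ht : 0 < t := hε.trans_le h1
  set X := hopfLaxFront f u₀ a t
  have hX : X ≤ hopfLaxFront f u₀ a T := h.front_monotoneOn a ht hT0 h2
  have hbd : ∀ y, A ≤ y → y ≤ X →
      0 ≤ (X - y) / t ∧ (X - y) / t ≤ (hopfLaxFront f u₀ a T - A) / ε := fun y h3 h4 =>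
    ⟨div_nonneg (by linarith) ht.le, div_le_div₀ (by linarith) (by linarith) hε h1⟩
  have hm := hA t ht h2
  have hp := h.yMinus_le_yPlus X ht
  have hpX := h.yPlus_le X ht
  obtain ⟨b1, b2⟩ := hbd _ hm (hp.trans hpX)
  obtain ⟨b3, b4⟩ := hbd _ (hm.trans hp) hpX
  obtain ⟨w1, w2⟩ := h.shockWeight_mem_Icc (rhoPlus f u₀ X t) (rhoMinus f u₀ X t)
  unfold meanSpeed
  set θ := shockWeight f (rhoPlus f u₀ X t) (rhoMinus f u₀ X t)
  have n1 := mul_nonneg w1 b1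
  have n2 := mul_nonneg (sub_nonneg.mpr w2) b3
  rw [abs_of_nonneg (add_nonneg n1 n2)]
  have n3 := mul_le_mul_of_nonneg_left b2 w1
  have n4 := mul_le_mul_of_nonneg_left b4 (sub_nonneg.mpr w2)
  linarith

/-- Measurability needs no analysis of the minimizers: this function is a right derivative. -/
theorem aestronglyMeasurable_meanSpeed_front (h : HopfLaxSetting f u₀) (a : ℝ) {ε : ℝ}
    (hε : 0 < ε) : AEStronglyMeasurable
      (fun t => meanSpeed f u₀ (hopfLaxFront f u₀ a t) t) (volume.restrict (Ioi ε)) := by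
  refine (measurable_derivWithin_Ioi (hopfLaxFront f u₀ a)).aestronglyMeasurable.congr ?_
  filter_upwards [ae_restrict_mem measurableSet_Ioi] with t ht
  exact (h.hasDerivWithinAt_front a (hε.trans ht)).derivWithin (uniqueDiffWithinAt_Ioi t)

/-- The step functions along fronts solve the weak transport equation. -/
theorem solvesFrom_frontStep (h : HopfLaxSetting f u₀) (hφ : IsTestFunction φ R K)
    {μ : ℝ → SignedMeasure ℝ}
    (hμ : IsFluxMeasureFamily (fun x t => deriv f (rhoPlus f u₀ x t)) φ R μ) (a : ℝ) {ε : ℝ}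
    (hε : 0 < ε) : SolvesFrom φ μ ε (frontStep f u₀ a) := by
  set X := hopfLaxFront f u₀ a
  set W : ℝ → ℝ := fun t => ∫ x in Ioi (X t), φ (x, t) with hW
  set σ : ℝ → ℝ := fun t => meanSpeed f u₀ (X t) t
  -- From time `b` on the test function vanishes, so all time integrals reduce to `(ε, b]`.
  set b := max ε R
  have hεb : ε ≤ b := le_max_left _ _
  have hRb : R ≤ b := le_max_right _ _
  have hzero : ∀ t x, R ≤ t → φ (x, t) = 0 := fun t x ht =>
    hφ.zero x t (Or.inr (ht.trans (le_abs_self t)))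
  have hzero' : ∀ t x, R ≤ t → timeDeriv φ x t = 0 := fun t x ht =>
    hφ.timeDeriv_zero (Or.inr (ht.trans (le_abs_self t)))
  have hXc : ContinuousOn X (Ioi 0) := h.continuousOn_front a
  have hWd : ∀ t, 0 < t → HasDerivWithinAt W
      ((∫ x in Ioi (X t), timeDeriv φ x t) - φ (X t, t) * σ t) (Ioi t) t := fun t ht =>
    hφ.hasDerivWithinAt_tail (h.hasDerivWithinAt_front a ht)
  have hWc : ContinuousOn W (Ioi 0) := by
    have e1 : W = (fun p : ℝ × ℝ => ∫ r in Ioi (0 : ℝ), φ (p + (r, 0))) ∘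
        fun t => (X t, t) := by
      funext t
      rw [hW]
      simp only [Function.comp_apply]
      rw [IsTestFunction.setIntegral_Ioi_eq_shift]
      simp
    rw [e1]
    have hc : Continuous fun p : ℝ × ℝ => ∫ r in Ioi (0 : ℝ), φ (p + (r, 0)) :=
      continuous_iff_continuousAt.mpr fun p => (hφ.hasFDerivAt_tail p).continuousAt
    exact hc.comp_continuousOn (hXc.prodMk continuousOn_id)
  obtain ⟨C, hC⟩ := h.meanSpeed_front_le a (T := b) hε
  have hsub : Ioc ε b ⊆ Ioi ε := Ioc_subset_Ioi_self
  -- the flux term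
  have hB : IntegrableOn (fun t => φ (X t, t) * σ t) (Ioi ε) := by
    have hm : AEStronglyMeasurable (fun t => φ (X t, t) * σ t) (volume.restrict (Ioi ε)) := by
      refine AEStronglyMeasurable.mul ?_ (h.aestronglyMeasurable_meanSpeed_front a hε)
      exact ((hφ.continuous.comp_continuousOn (hXc.prodMk continuousOn_id)).mono
        (Ioi_subset_Ioi hε.le)).aestronglyMeasurable measurableSet_Ioi
    have hI : IntegrableOn (fun t => φ (X t, t) * σ t) (Ioc ε b) := by
      refine Integrable.of_bound (hm.mono_measure (Measure.restrict_mono hsub le_rfl)) (K * C) ?_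
      filter_upwards [ae_restrict_mem measurableSet_Ioc] with t ht
      rw [norm_mul]
      exact mul_le_mul (hφ.bound _) (hC t ht.1.le ht.2) (norm_nonneg _) hφ.nonneg
    refine hI.of_forall_sdiff_eq_zero measurableSet_Ioi fun t ht => ?_
    rw [hzero t _ (hRb.trans (le_of_lt (by by_contra! hle; exact ht.2 ⟨ht.1, hle⟩))), zero_mul]
  -- the time derivative of the integral to the right of the front
  have hDm : AEStronglyMeasurable
      (fun t => (∫ x in Ioi (X t), timeDeriv φ x t) - φ (X t, t) * σ t)
      (volume.restrict (Ioi ε)) := by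
    refine (measurable_derivWithin_Ioi W).aestronglyMeasurable.congr ?_
    filter_upwards [ae_restrict_mem measurableSet_Ioi] with t ht
    exact (hWd t (hε.trans ht)).derivWithin (uniqueDiffWithinAt_Ioi t)
  have hA : IntegrableOn (fun t => ∫ x in Ioi (X t), timeDeriv φ x t) (Ioi ε) := by
    have hm : AEStronglyMeasurable (fun t => ∫ x in Ioi (X t), timeDeriv φ x t)
        (volume.restrict (Ioi ε)) := by
      refine (hDm.add hB.aestronglyMeasurable).congr (Eventually.of_forall fun t => ?_)
      simp
    have hI : IntegrableOn (fun t => ∫ x in Ioi (X t), timeDeriv φ x t) (Ioc ε b) := by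
      refine Integrable.of_bound (hm.mono_measure (Measure.restrict_mono hsub le_rfl))
        (K * (2 * R)) ?_
      refine Eventually.of_forall fun t => ?_
      calc ‖∫ x in Ioi (X t), timeDeriv φ x t‖ ≤ ∫ x in Ioi (X t), ‖timeDeriv φ x t‖ :=
            norm_integral_le_integral_norm _
        _ ≤ ∫ x, ‖timeDeriv φ x t‖ := setIntegral_le_integral (hφ.integrable_timeDeriv t).norm
            (Eventually.of_forall fun _ => norm_nonneg _)
        _ = ∫ x in Icc (-R) R, ‖timeDeriv φ x t‖ := by
            rw [setIntegral_eq_integral_of_forall_compl_eq_zero]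
            intro x hx
            rw [hφ.timeDeriv_zero (Or.inl ?_), norm_zero]
            by_contra! hlt
            exact hx ⟨(abs_lt.mp hlt).1.le, (abs_lt.mp hlt).2.le⟩
        _ ≤ ∫ x in Icc (-R) R, K := by
            refine setIntegral_mono (hφ.integrable_timeDeriv t).norm.integrableOn
              (integrableOn_const measure_Icc_lt_top.ne) fun x => hφ.timeDeriv_le x t
        _ = K * (2 * R) := by
            have hR := hφ.pos
            rw [setIntegral_const, Real.volume_real_Icc_of_le (by linarith), smul_eq_mul]
            ring
    refine hI.of_forall_sdiff_eq_zero measurableSet_Ioi fun t ht => ?_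
    have htR : R ≤ t := hRb.trans (le_of_lt (by by_contra! hle; exact ht.2 ⟨ht.1, hle⟩))
    simp [hzero' t _ htR]
  have hFTC : ∫ t in Ioi ε, ((∫ x in Ioi (X t), timeDeriv φ x t) - φ (X t, t) * σ t) = -W ε := by
    have h1 : ∫ t in ε..b, ((∫ x in Ioi (X t), timeDeriv φ x t) - φ (X t, t) * σ t) =
        W b - W ε := by
      -- Only right derivatives of the tail integral are known; its continuity and their
      -- integrability make this sufficient.
      refine intervalIntegral.integral_eq_sub_of_hasDeriv_right ?_ ?_ ?_
      · rw [uIcc_of_le hεb]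
        exact hWc.mono fun t ht => hε.trans_le ht.1
      · intro t ht
        rw [min_eq_left hεb] at ht
        exact hWd t (hε.trans ht.1)
      · rw [intervalIntegrable_iff_integrableOn_Ioc_of_le hεb]
        exact (hA.sub hB).mono_set hsub
    have h2 : W b = 0 := by
      simp only [hW]
      simp [hzero b _ hRb]
    rw [h2, zero_sub, intervalIntegral.integral_of_le hεb] at h1
    rw [← h1]
    refine (setIntegral_eq_of_subset_of_forall_sdiff_eq_zero measurableSet_Ioi hsub
      fun t ht => ?_)
    have htR : R ≤ t := hRb.trans (le_of_lt (by by_contra! hle; exact ht.2 ⟨ht.1, hle⟩))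
    simp [hzero' t _ htR, hzero t _ htR]
  have eA : ∀ t, ∫ x, timeDeriv φ x t * frontStep f u₀ a x t =
      ∫ x in Ioi (X t), timeDeriv φ x t := fun t => integral_mul_frontStep _ a t
  have eB : EqOn (fun t => ∫ᵛ x, frontStep f u₀ a x t ∂•(μ t)) (fun t => -(φ (X t, t) * σ t))
      (Ioi ε) := fun t ht => h.integral_frontStep hφ hμ a (hε.trans ht)
  refine ⟨fun t => measurable_jumpStep _ _, ⟨1, fun x t _ => ?_⟩, ?_, ?_, ?_⟩
  · have := jumpStep_mem_Icc (X := X t) (h.shockWeight_mem_Icc (rhoPlus f u₀ (X t) t)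
      (rhoMinus f u₀ (X t) t)) x
    rw [frontStep, abs_of_nonneg this.1]
    exact this.2
  · simp_rw [eA]; exact hA
  · exact (integrableOn_congr_fun eB measurableSet_Ioi).mpr hB.neg
  · simp_rw [eA]
    rw [setIntegral_congr_fun measurableSet_Ioi eB, integral_neg, ← sub_eq_add_neg,
      ← integral_sub hA hB]
    have e3 : ∫ x, frontStep f u₀ a x ε * φ (x, ε) = W ε := by
      simp_rw [mul_comm (frontStep f u₀ a _ ε)]
      exact integral_mul_frontStep (fun x => φ (x, ε)) a ε
    rw [hFTC, e3, neg_add_cancel]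

end HopfLaxSetting

/-! ### Approximation of the transported data by step functions along fronts -/

/-- Coefficients of the staircase approximation of `v` on the grid `a`. -/
def staircaseCoeff (v : ℝ → ℝ) (a : ℕ → ℝ) : ℕ → ℝ
  | 0 => v (a 0)
  | i + 1 => v (a (i + 1)) - v (a i)

/-- The sum telescopes: up to the last grid point below `y` it equals `v` there, and one more term
can at most move it to the next grid value. Both values of `p i` are allowed at `y = a i`, since
fronts give only weak inequalities for extreme minimizers. -/
theorem abs_staircase_sub_le {v : ℝ → ℝ} {a p : ℕ → ℝ} {y δ : ℝ} {N : ℕ} (ha : StrictMono a)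
    (hp : ∀ i, (p i = 1 ∧ a i ≤ y) ∨ (p i = 0 ∧ y ≤ a i)) (h0 : a 0 < y) (hN : y ≤ a N)
    (hv : ∀ i < N, ∀ s ∈ Icc (a i) (a (i + 1)), ∀ z ∈ Icc (a i) (a (i + 1)), |v s - v z| ≤ δ) :
    |∑ i ∈ Finset.range (N + 1), staircaseCoeff v a i * p i - v y| ≤ δ := by
  have key : ∀ n ≤ N,
      (a n < y → ∑ i ∈ Finset.range (n + 1), staircaseCoeff v a i * p i = v (a n)) ∧
      (y ≤ a n → |∑ i ∈ Finset.range (n + 1), staircaseCoeff v a i * p i - v y| ≤ δ) := by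
    intro n
    induction n with
    | zero =>
      intro _
      refine ⟨fun _ => ?_, fun hle => absurd hle (not_le.mpr h0)⟩
      rcases hp 0 with ⟨h1, _⟩ | ⟨_, h1⟩
      · simp [staircaseCoeff, h1]
      · exact absurd h1 (not_le.mpr h0)
    | succ n ih =>
      intro hn
      obtain ⟨ih1, ih2⟩ := ih (by omega)
      have hlt := ha n.lt_succ_self
      rw [Finset.sum_range_succ]
      change (_ → _ + (v (a (n + 1)) - v (a n)) * p (n + 1) = _) ∧
        (_ → |_ + (v (a (n + 1)) - v (a n)) * p (n + 1) - v y| ≤ δ)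
      refine ⟨fun hy => ?_, fun hy => ?_⟩
      · rcases hp (n + 1) with ⟨h1, _⟩ | ⟨_, h1⟩
        · rw [ih1 (hlt.trans hy), h1]; ring
        · exact absurd h1 (not_le.mpr hy)
      · rcases lt_or_ge (a n) y with hny | hny
        · rw [ih1 hny]
          have hymem : y ∈ Icc (a n) (a (n + 1)) := ⟨hny.le, hy⟩
          rcases hp (n + 1) with ⟨h1, _⟩ | ⟨h1, _⟩
          · rw [h1, mul_one, add_sub_cancel]
            exact hv n (by omega) _ (right_mem_Icc.mpr hlt.le) _ hymem
          · rw [h1, mul_zero, add_zero]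
            exact hv n (by omega) _ (left_mem_Icc.mpr hlt.le) _ hymem
        · rcases hp (n + 1) with ⟨_, h1⟩ | ⟨h1, _⟩
          · exact absurd (hny.trans_lt hlt) (not_lt.mpr h1)
          · rw [h1, mul_zero, add_zero]; exact ih2 hny
  exact (key N le_rfl).2 hN

theorem abs_setIntegral_le {F : ℝ → ℝ} {s : Set ℝ} {C a b : ℝ} (hs : MeasurableSet s)
    (hC : 0 ≤ C) (hab : a ≤ b) (h0 : ∀ x ∈ s, x ∉ Icc a b → F x = 0)
    (hF : ∀ x ∈ s, x ∈ Icc a b → |F x| ≤ C) : |∫ x in s, F x| ≤ C * (b - a) := by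
  have hi : Integrable ((Icc a b).indicator fun _ => C) :=
    (integrable_indicator_iff measurableSet_Icc).mpr (integrableOn_const measure_Icc_lt_top.ne)
  have h1 : ‖∫ x in s, F x‖ ≤ ∫ x in s, (Icc a b).indicator (fun _ => C) x := by
    refine norm_integral_le_of_norm_le hi.integrableOn ?_
    filter_upwards [ae_restrict_mem hs] with x hx
    by_cases hx' : x ∈ Icc a b
    · rw [indicator_of_mem hx']; exact hF x hx hx'
    · rw [indicator_of_notMem hx', h0 x hx hx', norm_zero]
  refine h1.trans ((setIntegral_le_integral hi (Eventually.of_forall fun x =>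
    indicator_nonneg (fun _ _ => hC) x)).trans_eq ?_)
  rw [integral_indicator measurableSet_Icc, setIntegral_const, Real.volume_real_Icc_of_le hab,
    smul_eq_mul, mul_comm]

namespace HopfLaxSetting

variable {f u₀ v₀ : ℝ → ℝ} {φ : ℝ × ℝ → ℝ} {R K : ℝ}

/-- The step function of a front splits according to the two extreme minimizers. -/
theorem frontStep_eq (a x t : ℝ) :
    frontStep f u₀ a x t =
      shockWeight f (rhoPlus f u₀ x t) (rhoMinus f u₀ x t) *
        (if hopfLaxFront f u₀ a t ≤ x then 1 else 0) +
      (1 - shockWeight f (rhoPlus f u₀ x t) (rhoMinus f u₀ x t)) *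
        (if hopfLaxFront f u₀ a t < x then 1 else 0) := by
  rcases lt_trichotomy x (hopfLaxFront f u₀ a t) with hx | hx | hx
  · rw [frontStep, jumpStep_of_gt hx, if_neg (not_le.mpr hx), if_neg (not_lt.mpr hx.le)]; ring
  · rw [if_pos hx.ge, if_neg hx.not_gt, hx, frontStep, jumpStep_self]; ring
  · rw [frontStep, jumpStep_of_lt hx, if_pos hx.le, if_pos hx]; ring

theorem abs_convexComb_le {θ p q δ : ℝ} (hθ : θ ∈ Icc (0 : ℝ) 1) (hp : |p| ≤ δ) (hq : |q| ≤ δ) :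
    |θ * p + (1 - θ) * q| ≤ δ := by
  obtain ⟨h1, h2⟩ := hθ
  obtain ⟨p1, p2⟩ := abs_le.mp hp
  obtain ⟨q1, q2⟩ := abs_le.mp hq
  rw [abs_le]
  constructor <;> nlinarith

/-- By `frontStep_eq` the weights at `(x, t)` are the same for every level. The error is thus a
convex combination of the staircase errors at `y⁺` and `y⁻`. -/
theorem exists_staircase_approximation (h : HopfLaxSetting f u₀) (hv₀ : Continuous v₀)
    (hφ : IsTestFunction φ R K) {μ : ℝ → SignedMeasure ℝ}
    (hμ : IsFluxMeasureFamily (fun x t => deriv f (rhoPlus f u₀ x t)) φ R μ) {δ : ℝ}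
    (hδ : 0 < δ) :
    ∃ S : ℝ → ℝ → ℝ, (∀ ε, 0 < ε → SolvesFrom φ μ ε S) ∧
      ∀ x t, x ∈ Icc (-R) R → 0 < t → t ≤ R → |S x t - transportedData f u₀ v₀ x t| ≤ δ := by
  have hR := hφ.pos
  obtain ⟨A, hA⟩ := h.exists_yMinus_lower_bound hR
  have hAR : A ≤ R := (hA R R (by linarith) hR le_rfl).trans ((h.isHopfLaxMin_yMinus R hR).le h hR)
  have huc := isCompact_Icc.uniformContinuousOn_of_continuous
    (hv₀.continuousOn (s := Icc (A - 1) R))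
  obtain ⟨η, hη, hu⟩ := Metric.uniformContinuousOn_iff.mp huc δ hδ
  obtain ⟨n, hn⟩ := exists_nat_gt ((R - (A - 1)) / η)
  have hlen : 0 < R - (A - 1) := by linarith
  have hn0 : (0 : ℝ) < n := (div_pos hlen hη).trans hn
  obtain ⟨d, hd⟩ : ∃ d, d = (R - (A - 1)) / n := ⟨_, rfl⟩
  have hd0 : 0 < d := by rw [hd]; exact div_pos hlen hn0
  have hdη : d < η := by
    rw [hd, div_lt_iff₀ hn0]
    rw [div_lt_iff₀ hη] at hn
    linarith
  -- The grid starts at `A - 1`, not `A`, so that its first point lies strictly below every relevant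
  -- minimizer.
  set a : ℕ → ℝ := fun i => A - 1 + i * d with ha_def
  have ha : StrictMono a := fun i j hij =>
    add_lt_add_right (mul_lt_mul_of_pos_right (Nat.cast_lt.mpr hij) hd0) (A - 1)
  have ha0 : a 0 = A - 1 := by simp [ha_def]
  have haN : a n = R := by simp only [ha_def, hd]; field_simp; ring
  have hosc : ∀ i < n, ∀ s ∈ Icc (a i) (a (i + 1)), ∀ z ∈ Icc (a i) (a (i + 1)),
      |v₀ s - v₀ z| ≤ δ := by
    intro i hi s hs z hz
    have h1 : A - 1 ≤ a i := ha0 ▸ ha.monotone (Nat.zero_le i)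
    have h2 : a (i + 1) ≤ R := haN ▸ ha.monotone hi
    have h3 : a (i + 1) = a i + d := by simp only [ha_def]; push_cast; ring
    have h4 : dist s z < η := by
      rw [Real.dist_eq, abs_lt]
      constructor <;> linarith [hs.1, hs.2, hz.1, hz.2]
    have := hu s ⟨h1.trans hs.1, hs.2.trans h2⟩ z ⟨h1.trans hz.1, hz.2.trans h2⟩ h4
    rw [Real.dist_eq] at this
    exact this.le
  refine ⟨fun x t => ∑ i ∈ Finset.range (n + 1),
    staircaseCoeff v₀ a i * frontStep f u₀ (a i) x t, fun ε hε =>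
    SolvesFrom.sum hφ hμ (fun i => h.solvesFrom_frontStep hφ hμ (a i) hε) _ _, ?_⟩
  intro x t hx ht htR
  have hym := hA x t hx.1 ht htR
  have hmp := h.yMinus_le_yPlus x ht
  have hpx := h.yPlus_le x ht
  set θ := shockWeight f (rhoPlus f u₀ x t) (rhoMinus f u₀ x t)
  have hP := abs_staircase_sub_le (v := v₀) (y := yPlus f u₀ x t) (δ := δ) (N := n)
    (p := fun i => if hopfLaxFront f u₀ (a i) t ≤ x then 1 else 0) ha
    (fun i => by
      by_cases hc : hopfLaxFront f u₀ (a i) t ≤ x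
      · exact Or.inl ⟨if_pos hc, (h.le_yPlus_front (a i) ht).trans (h.monotone_yPlus ht hc)⟩
      · exact Or.inr ⟨if_neg hc, h.yPlus_le_of_lt_front ht (not_le.mp hc)⟩)
    (by linarith) (by linarith [hx.2]) hosc
  have hQ := abs_staircase_sub_le (v := v₀) (y := yMinus f u₀ x t) (δ := δ) (N := n)
    (p := fun i => if hopfLaxFront f u₀ (a i) t < x then 1 else 0) ha
    (fun i => by
      by_cases hc : hopfLaxFront f u₀ (a i) t < x
      · exact Or.inl ⟨if_pos hc, ((h.lt_yMinus_iff ht).mpr hc).le⟩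
      · exact Or.inr ⟨if_neg hc, (h.yMinus_le_iff ht).mpr (not_lt.mp hc)⟩)
    (by linarith) (by linarith [hx.2]) hosc
  have e : ∑ i ∈ Finset.range (n + 1), staircaseCoeff v₀ a i * frontStep f u₀ (a i) x t -
      transportedData f u₀ v₀ x t =
      θ * (∑ i ∈ Finset.range (n + 1), staircaseCoeff v₀ a i *
        (if hopfLaxFront f u₀ (a i) t ≤ x then 1 else 0) - v₀ (yPlus f u₀ x t)) +
      (1 - θ) * (∑ i ∈ Finset.range (n + 1), staircaseCoeff v₀ a i *
        (if hopfLaxFront f u₀ (a i) t < x then 1 else 0) - v₀ (yMinus f u₀ x t)) := by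
    rw [mul_sub, mul_sub, Finset.mul_sum, Finset.mul_sum, transportedData]
    have e1 : ∑ i ∈ Finset.range (n + 1), staircaseCoeff v₀ a i * frontStep f u₀ (a i) x t =
        (∑ i ∈ Finset.range (n + 1), θ * (staircaseCoeff v₀ a i *
          (if hopfLaxFront f u₀ (a i) t ≤ x then 1 else 0))) +
        ∑ i ∈ Finset.range (n + 1), (1 - θ) * (staircaseCoeff v₀ a i *
          (if hopfLaxFront f u₀ (a i) t < x then 1 else 0)) := by
      rw [← Finset.sum_add_distrib]
      refine Finset.sum_congr rfl fun i _ => ?_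
      rw [frontStep_eq]
      ring
    rw [e1]
    ring
  rw [e]
  exact abs_convexComb_le (h.shockWeight_mem_Icc _ _) hP hQ

/-! ### Measurability and bounds of the transported data -/

/-- The transported data agree for `t > 0` with a Borel function of `(x, t)`. -/
theorem exists_measurable_transportedData (h : HopfLaxSetting f u₀) (hv₀ : Continuous v₀) :
    ∃ V : ℝ × ℝ → ℝ, Measurable V ∧
      ∀ x t, 0 < t → V (x, t) = transportedData f u₀ v₀ x t := by
  classical
  set ym : ℝ × ℝ → ℝ := fun p => if 0 < p.2 then yMinus f u₀ p.1 p.2 else 0 with hym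
  set yp : ℝ × ℝ → ℝ := fun p => if 0 < p.2 then yPlus f u₀ p.1 p.2 else 0 with hyp
  have hpos : MeasurableSet {p : ℝ × ℝ | 0 < p.2} := measurableSet_lt measurable_const measurable_snd
  have hymM : Measurable ym := by
    refine measurable_of_Iic fun a => ?_
    -- Sublevel sets of `y⁻` are the regions on or left of a front, and fronts are continuous in
    -- time.
    have hX : Measurable ((Ioi (0 : ℝ)).piecewise (hopfLaxFront f u₀ a) fun _ => 0) :=
      (h.continuousOn_front a).measurable_piecewise continuousOn_const measurableSet_Ioi
    have e : ym ⁻¹' Iic a = ({p : ℝ × ℝ | 0 < p.2} ∩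
        {p : ℝ × ℝ | p.1 ≤ (Ioi (0 : ℝ)).piecewise (hopfLaxFront f u₀ a) (fun _ => 0) p.2}) ∪
        ({p : ℝ × ℝ | 0 < p.2}ᶜ ∩ {_p : ℝ × ℝ | 0 ≤ a}) := by
      ext ⟨x, t⟩
      by_cases ht : 0 < t
      · simp [hym, ht, h.yMinus_le_iff ht]
      · simp [hym, ht]
    rw [e]
    exact (hpos.inter (measurableSet_le measurable_fst (hX.comp measurable_snd))).union
      (hpos.compl.inter (MeasurableSet.const _))
  have hypM : Measurable yp := by
    -- `y⁺` is the limit of `y⁻` at points approaching `x` from the right.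
    refine measurable_of_tendsto_metrizable
      (f := fun (n : ℕ) (p : ℝ × ℝ) => ym (p.1 + 1 / ((n : ℝ) + 1), p.2))
      (fun n => hymM.comp (by fun_prop)) ?_
    rw [tendsto_pi_nhds]
    rintro ⟨x, t⟩
    by_cases ht : 0 < t
    · simp only [hym, hyp, if_pos ht]
      refine (h.tendsto_yMinus_right x ht).comp (tendsto_nhdsWithin_iff.mpr ⟨?_, ?_⟩)
      · simpa using tendsto_const_nhds.add (tendsto_one_div_add_atTop_nhds_zero_nat (𝕜 := ℝ))
      · exact Eventually.of_forall fun n => by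
          have : (0 : ℝ) < 1 / ((n : ℝ) + 1) := Nat.one_div_pos_of_nat
          exact lt_add_of_pos_right x this
    · simp only [hym, hyp, if_neg ht]
      exact tendsto_const_nhds
  have hr := h.continuous_deriv_conjugate.measurable
  have hrp : Measurable fun p : ℝ × ℝ => deriv (convexConjugate f) ((p.1 - yp p) / p.2) :=
    hr.comp ((measurable_fst.sub hypM).div measurable_snd)
  have hrm : Measurable fun p : ℝ × ℝ => deriv (convexConjugate f) ((p.1 - ym p) / p.2) :=
    hr.comp ((measurable_fst.sub hymM).div measurable_snd)
  have hf := h.diff.continuous.measurable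
  have hf' := measurable_deriv f
  have hw : Measurable fun p : ℝ × ℝ =>
      shockWeight f (deriv (convexConjugate f) ((p.1 - yp p) / p.2))
        (deriv (convexConjugate f) ((p.1 - ym p) / p.2)) := by
    unfold shockWeight
    exact ((((hf.comp hrp).sub (hf.comp hrm)).div (hrp.sub hrm)).sub (hf'.comp hrp)).div
      ((hf'.comp hrm).sub (hf'.comp hrp))
  refine ⟨_, (hw.mul (hv₀.measurable.comp hypM)).add
    (((measurable_const (a := (1 : ℝ))).sub hw).mul (hv₀.measurable.comp hymM)), fun x t ht => ?_⟩
  simp only [transportedData, rhoPlus, rhoMinus, hym, hyp, if_pos ht, Function.comp_apply,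
    Pi.add_apply, Pi.mul_apply, Pi.sub_apply]

theorem exists_transportedData_le (h : HopfLaxSetting f u₀) (hv₀ : Continuous v₀) (hR : 0 < R) :
    ∃ C, 0 ≤ C ∧ ∀ x t, x ∈ Icc (-R) R → 0 < t → t ≤ R → |transportedData f u₀ v₀ x t| ≤ C := by
  obtain ⟨A, hA⟩ := h.exists_yMinus_lower_bound hR
  obtain ⟨C, hC⟩ := isCompact_Icc.exists_bound_of_continuousOn (hv₀.continuousOn (s := Icc A R))
  refine ⟨max C 0, le_max_right _ _, fun x t hx ht htR => ?_⟩
  have hym := hA x t hx.1 ht htR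
  have hmp := h.yMinus_le_yPlus x ht
  have hpx := h.yPlus_le x ht
  exact abs_convexComb_le (h.shockWeight_mem_Icc _ _)
    ((hC _ ⟨hym.trans hmp, hpx.trans hx.2⟩).trans (le_max_left _ _))
    ((hC _ ⟨hym, (hmp.trans hpx).trans hx.2⟩).trans (le_max_left _ _))

/-- The transported data attain the initial values pointwise. -/
theorem tendsto_transportedData (h : HopfLaxSetting f u₀) (hv₀ : Continuous v₀) (x : ℝ) :
    Tendsto (fun t => transportedData f u₀ v₀ x t) (𝓝[>] 0) (𝓝 (v₀ x)) := by
  have hp := (hv₀.tendsto x).comp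
    (h.tendsto_of_isHopfLaxMin (x := x) fun t ht => h.isHopfLaxMin_yPlus x ht)
  have hm := (hv₀.tendsto x).comp
    (h.tendsto_of_isHopfLaxMin (x := x) fun t ht => h.isHopfLaxMin_yMinus x ht)
  rw [tendsto_iff_norm_sub_tendsto_zero] at hp hm ⊢
  have hsum := hp.add hm
  rw [add_zero] at hsum
  refine squeeze_zero (fun _ => norm_nonneg _) (fun t => ?_) hsum
  have e : transportedData f u₀ v₀ x t - v₀ x =
      shockWeight f (rhoPlus f u₀ x t) (rhoMinus f u₀ x t) * (v₀ (yPlus f u₀ x t) - v₀ x) +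
      (1 - shockWeight f (rhoPlus f u₀ x t) (rhoMinus f u₀ x t)) *
        (v₀ (yMinus f u₀ x t) - v₀ x) := by
    unfold transportedData; ring
  rw [e]
  exact abs_convexComb_le (h.shockWeight_mem_Icc _ _)
    (le_add_of_nonneg_right (norm_nonneg _)) (le_add_of_nonneg_left (norm_nonneg _))

end HopfLaxSetting

/-! ### The transport equation for the transported data -/

namespace HopfLaxSetting

variable {f u₀ v₀ : ℝ → ℝ} {φ : ℝ × ℝ → ℝ} {R K : ℝ} {μ : ℝ → SignedMeasure ℝ}

theorem measurable_transportedData (h : HopfLaxSetting f u₀) (hv₀ : Continuous v₀) {t : ℝ}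
    (ht : 0 < t) : Measurable fun x => transportedData f u₀ v₀ x t := by
  obtain ⟨V, hV, hVeq⟩ := h.exists_measurable_transportedData hv₀
  have : (fun x => transportedData f u₀ v₀ x t) = fun x => V (x, t) :=
    funext fun x => (hVeq x t ht).symm
  rw [this]
  exact hV.comp measurable_prodMk_right

theorem integrable_flux_slice (h : HopfLaxSetting f u₀) (hv₀ : Continuous v₀)
    (hφ : IsTestFunction φ R K)
    (hμ : IsFluxMeasureFamily (fun x t => deriv f (rhoPlus f u₀ x t)) φ R μ) {t : ℝ}
    (ht : 0 < t) : (μ t).Integrable fun x => transportedData f u₀ v₀ x t := by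
  rcases le_or_gt R t with htR | htR
  · rw [hμ.zero t htR]
    exact VectorMeasure.Integrable.zero_vectorMeasure
  · have := hμ.finite t
    obtain ⟨C, -, hC⟩ := h.exists_transportedData_le hv₀ hφ.pos
    refine SignedMeasure.integrable_of_bounded (C := C) (h.measurable_transportedData hv₀ ht) ?_
    filter_upwards [hμ.supp t] with x hx using hC x t (Ioc_subset_Icc_self hx) ht htR.le

theorem integrableOn_timeDeriv_mul (h : HopfLaxSetting f u₀) (hv₀ : Continuous v₀)
    (hφ : IsTestFunction φ R K) :
    IntegrableOn (fun p : ℝ × ℝ => timeDeriv φ p.1 p.2 * transportedData f u₀ v₀ p.1 p.2)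
      (univ ×ˢ Ioi 0) := by
  obtain ⟨V, hV, hVeq⟩ := h.exists_measurable_transportedData hv₀
  obtain ⟨C, hC0, hC⟩ := h.exists_transportedData_le hv₀ hφ.pos
  have hS : MeasurableSet ((univ : Set ℝ) ×ˢ Ioi (0 : ℝ)) := MeasurableSet.univ.prod measurableSet_Ioi
  have hQ : IsCompact (Icc (-R) R ×ˢ Icc (0 : ℝ) R) := isCompact_Icc.prod isCompact_Icc
  have hbd : Integrable ((Icc (-R) R ×ˢ Icc (0 : ℝ) R).indicator fun _ : ℝ × ℝ => K * C) :=
    (integrable_indicator_iff hQ.measurableSet).mpr (integrableOn_const hQ.measure_lt_top.ne)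
  refine hbd.integrableOn.mono' ?_ ?_
  · refine (hφ.continuous_timeDeriv.measurable.mul hV).aestronglyMeasurable.congr ?_
    filter_upwards [ae_restrict_mem hS] with p hp
    rw [Pi.mul_apply, ← Prod.mk.eta (p := p), hVeq p.1 p.2 hp.2]
  · filter_upwards [ae_restrict_mem hS] with p hp
    have hp2 : 0 < p.2 := hp.2
    by_cases hpQ : p ∈ Icc (-R) R ×ˢ Icc (0 : ℝ) R
    · rw [indicator_of_mem hpQ, norm_mul]
      exact mul_le_mul (hφ.timeDeriv_le _ _) (hC _ _ hpQ.1 hp2 hpQ.2.2) (norm_nonneg _) hφ.nonneg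
    · rw [indicator_of_notMem hpQ, hφ.timeDeriv_zero, zero_mul, norm_zero]
      by_contra! hlt
      exact hpQ ⟨⟨(abs_lt.mp hlt.1).1.le, (abs_lt.mp hlt.1).2.le⟩,
        ⟨hp2.le, (abs_lt.mp hlt.2).2.le⟩⟩

theorem integrableOn_integral_timeDeriv_mul (h : HopfLaxSetting f u₀) (hv₀ : Continuous v₀)
    (hφ : IsTestFunction φ R K) :
    IntegrableOn (fun t => ∫ x, timeDeriv φ x t * transportedData f u₀ v₀ x t) (Ioi 0) := by
  have h1 := h.integrableOn_timeDeriv_mul hv₀ hφ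
  rw [IntegrableOn, Measure.volume_eq_prod, ← Measure.prod_restrict, Measure.restrict_univ] at h1
  exact h1.integral_prod_right

theorem abs_integral_timeDeriv_sub_le (h : HopfLaxSetting f u₀) (hv₀ : Continuous v₀)
    (hφ : IsTestFunction φ R K) {S : ℝ → ℝ → ℝ} {δ ε t : ℝ} (hε : 0 < ε) (hεt : ε ≤ t)
    (htR : t ≤ R) (hS : SolvesFrom φ μ ε S) (hδ : 0 ≤ δ)
    (hSv : ∀ x t, x ∈ Icc (-R) R → 0 < t → t ≤ R →
      |S x t - transportedData f u₀ v₀ x t| ≤ δ) :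
    |(∫ x, timeDeriv φ x t * S x t) - ∫ x, timeDeriv φ x t * transportedData f u₀ v₀ x t| ≤
      K * δ * (R - -R) := by
  have ht := hε.trans_le hεt
  obtain ⟨C, hC⟩ := hS.bdd
  obtain ⟨C', -, hC'⟩ := h.exists_transportedData_le hv₀ hφ.pos
  have hout : ∀ x, x ∉ Icc (-R) R → timeDeriv φ x t = 0 := fun x hx => hφ.timeDeriv_zero (Or.inl (by
    by_contra! hlt
    exact hx ⟨(abs_lt.mp hlt).1.le, (abs_lt.mp hlt).2.le⟩))
  have i1 : Integrable fun x => timeDeriv φ x t * S x t :=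
    integrable_mul_of_bounded (hφ.integrable_timeDeriv t) (hS.meas t).aestronglyMeasurable
      (Eventually.of_forall fun x => hC x t hεt)
  have i2 : Integrable fun x => timeDeriv φ x t * transportedData f u₀ v₀ x t := by
    -- The transported data are bounded only for `x` in `[-R, R]`; cutting off there leaves the
    -- product unchanged.
    have hw := (h.measurable_transportedData hv₀ ht).indicator
      (measurableSet_Icc (a := -R) (b := R))
    refine (integrable_mul_of_bounded (C := max C' 0) (hφ.integrable_timeDeriv t)
      hw.aestronglyMeasurable (Eventually.of_forall fun x => ?_)).congr
      (Eventually.of_forall fun x => ?_)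
    · by_cases hx : x ∈ Icc (-R) R
      · rw [indicator_of_mem hx]; exact (hC' x t hx ht htR).trans (le_max_left _ _)
      · rw [indicator_of_notMem hx, abs_zero]; exact le_max_right _ _
    · by_cases hx : x ∈ Icc (-R) R
      · simp only [indicator_of_mem hx]
      · simp only [hout x hx, zero_mul]
  rw [← integral_sub i1 i2, ← setIntegral_univ]
  refine abs_setIntegral_le MeasurableSet.univ (mul_nonneg hφ.nonneg hδ) (by linarith [hφ.pos])
    (fun x _ hx => by rw [hout x hx]; ring) fun x _ hx => ?_
  rw [← mul_sub, abs_mul]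
  exact mul_le_mul (hφ.timeDeriv_le x t) (hSv x t hx ht htR) (abs_nonneg _) hφ.nonneg

theorem abs_flux_sub_le (h : HopfLaxSetting f u₀) (hv₀ : Continuous v₀)
    (hφ : IsTestFunction φ R K)
    (hμ : IsFluxMeasureFamily (fun x t => deriv f (rhoPlus f u₀ x t)) φ R μ)
    {S : ℝ → ℝ → ℝ} {δ ε t C : ℝ} (hε : 0 < ε) (hεt : ε ≤ t)
    (htR : t ≤ R) (hS : SolvesFrom φ μ ε S) (hδ : 0 ≤ δ)
    (hC : ∀ t, ε ≤ t → (μ t).variation.real univ ≤ C)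
    (hSv : ∀ x t, x ∈ Icc (-R) R → 0 < t → t ≤ R →
      |S x t - transportedData f u₀ v₀ x t| ≤ δ) :
    |(∫ᵛ x, S x t ∂•(μ t)) - ∫ᵛ x, transportedData f u₀ v₀ x t ∂•(μ t)| ≤ δ * C := by
  have ht := hε.trans_le hεt
  have := hμ.finite t
  obtain ⟨C', hC'⟩ := hS.bdd
  have i1 : (μ t).Integrable fun x => S x t := SignedMeasure.integrable_of_bounded (hS.meas t)
    (Eventually.of_forall fun x => hC' x t hεt)
  rw [← VectorMeasure.integral_fun_sub i1 (h.integrable_flux_slice hv₀ hφ hμ ht)]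
  have h1 := VectorMeasure.norm_integral_le_of_norm_le_const (μ := μ t)
    (B := ContinuousLinearMap.lsmul ℝ ℝ)
    (f := fun x => S x t - transportedData f u₀ v₀ x t) (C := δ)
    (by filter_upwards [hμ.supp t] with x hx using hSv x t (Ioc_subset_Icc_self hx) ht htR)
  refine h1.trans ?_
  rw [ContinuousLinearMap.opNorm_lsmul, mul_one]
  exact mul_le_mul_of_nonneg_left (hC t hεt) hδ

/-- The measures are chosen separately for each `t`, so measurability in `t` is not automatic. It is
inherited from the staircase approximations, whose flux integrals are explicit. -/
theorem integrableOn_flux (h : HopfLaxSetting f u₀) (hv₀ : Continuous v₀)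
    (hφ : IsTestFunction φ R K)
    (hμ : IsFluxMeasureFamily (fun x t => deriv f (rhoPlus f u₀ x t)) φ R μ) {ε : ℝ}
    (hε : 0 < ε) :
    IntegrableOn (fun t => ∫ᵛ x, transportedData f u₀ v₀ x t ∂•(μ t)) (Ioi ε) := by
  obtain ⟨C, hC⟩ := hμ.bound ε hε
  obtain ⟨C', hC'0, hC'⟩ := h.exists_transportedData_le hv₀ hφ.pos
  choose S hS hSv using fun n : ℕ =>
    h.exists_staircase_approximation hv₀ hφ hμ (δ := 1 / ((n : ℝ) + 1)) Nat.one_div_pos_of_nat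
  have hmeas : AEStronglyMeasurable (fun t => ∫ᵛ x, transportedData f u₀ v₀ x t ∂•(μ t))
      (volume.restrict (Ioi ε)) := by
    refine aestronglyMeasurable_of_tendsto_ae atTop
      (fun n => ((hS n ε hε).integrable_flux).aestronglyMeasurable) ?_
    filter_upwards [ae_restrict_mem measurableSet_Ioi] with t ht
    rcases le_or_gt R t with htR | htR
    · simp [hμ.zero t htR]
    · have hlim : Tendsto (fun n : ℕ => 1 / ((n : ℝ) + 1) * C) atTop (𝓝 0) := by
        simpa using (tendsto_one_div_add_atTop_nhds_zero_nat (𝕜 := ℝ)).mul_const C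
      refine tendsto_iff_norm_sub_tendsto_zero.mpr
        (squeeze_zero (fun _ => norm_nonneg _) (fun n => ?_) hlim)
      exact h.abs_flux_sub_le hv₀ hφ hμ hε (le_of_lt ht) htR.le (hS n ε hε)
        Nat.one_div_pos_of_nat.le hC (hSv n)
  have hzero : ∀ t, t ∉ Iic R → ∫ᵛ x, transportedData f u₀ v₀ x t ∂•(μ t) = 0 := fun t ht => by
    rw [hμ.zero t (not_le.mp ht).le]; exact VectorMeasure.integral_zero_vectorMeasure
  have hI : IntegrableOn (fun t => ∫ᵛ x, transportedData f u₀ v₀ x t ∂•(μ t)) (Ioc ε R) := by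
    refine Integrable.of_bound
      (hmeas.mono_measure (Measure.restrict_mono Ioc_subset_Ioi_self le_rfl)) (C' * C) ?_
    filter_upwards [ae_restrict_mem measurableSet_Ioc] with t ht
    have ht0 := hε.trans ht.1
    have := hμ.finite t
    have h1 := VectorMeasure.norm_integral_le_of_norm_le_const (μ := μ t)
      (B := ContinuousLinearMap.lsmul ℝ ℝ) (f := fun x => transportedData f u₀ v₀ x t) (C := C')
      (by filter_upwards [hμ.supp t] with x hx using hC' x t (Ioc_subset_Icc_self hx) ht0 ht.2)
    refine h1.trans ?_
    rw [ContinuousLinearMap.opNorm_lsmul, mul_one]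
    exact mul_le_mul_of_nonneg_left (hC t ht.1.le) hC'0
  exact hI.of_forall_sdiff_eq_zero measurableSet_Ioi fun t ht =>
    hzero t fun hle => ht.2 ⟨ht.1, hle⟩

/-- The transported data satisfy the weak transport equation from any positive time on. -/
theorem transport_identity (h : HopfLaxSetting f u₀) (hv₀ : Continuous v₀)
    (hφ : IsTestFunction φ R K)
    (hμ : IsFluxMeasureFamily (fun x t => deriv f (rhoPlus f u₀ x t)) φ R μ) {ε : ℝ}
    (hε : 0 < ε) :
    (∫ t in Ioi ε, ∫ x, timeDeriv φ x t * transportedData f u₀ v₀ x t) +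
      (∫ t in Ioi ε, ∫ᵛ x, transportedData f u₀ v₀ x t ∂•(μ t)) +
      ∫ x, transportedData f u₀ v₀ x ε * φ (x, ε) = 0 := by
  have hR := hφ.pos
  have hK := hφ.nonneg
  obtain ⟨C, hC⟩ := hμ.bound ε hε
  have hC0 : 0 ≤ C := measureReal_nonneg.trans (hC ε le_rfl)
  have iA := (h.integrableOn_integral_timeDeriv_mul hv₀ hφ).mono_set (Ioi_subset_Ioi hε.le)
  have iB := h.integrableOn_flux hv₀ hφ hμ hε
  obtain ⟨C', -, hC'⟩ := h.exists_transportedData_le hv₀ hR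
  have hzero : ∀ t x, R ≤ t → timeDeriv φ x t = 0 := fun t x ht =>
    hφ.timeDeriv_zero (Or.inr (ht.trans (le_abs_self t)))
  have hslice : ∀ x, x ∉ Icc (-R) R ∨ R < ε → φ (x, ε) = 0 := by
    rintro x (hx | hx)
    · refine hφ.zero x ε (Or.inl ?_)
      by_contra! hlt
      exact hx ⟨(abs_lt.mp hlt).1.le, (abs_lt.mp hlt).2.le⟩
    · exact hφ.zero x ε (Or.inr (hx.le.trans (le_abs_self ε)))
  have iC : Integrable fun x => transportedData f u₀ v₀ x ε * φ (x, ε) := by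
    rcases lt_or_ge R ε with hRε | hRε
    · simp [hslice _ (Or.inr hRε)]
    have hw := (h.measurable_transportedData hv₀ hε).indicator
      (measurableSet_Icc (a := -R) (b := R))
    refine (integrable_mul_of_bounded (C := max C' 0) (hφ.integrable_slice ε)
      hw.aestronglyMeasurable (Eventually.of_forall fun x => ?_)).congr
      (Eventually.of_forall fun x => ?_)
    · by_cases hx : x ∈ Icc (-R) R
      · rw [indicator_of_mem hx]; exact (hC' x ε hx hε hRε).trans (le_max_left _ _)
      · rw [indicator_of_notMem hx, abs_zero]; exact le_max_right _ _
    · by_cases hx : x ∈ Icc (-R) R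
      · simp only [indicator_of_mem hx, mul_comm]
      · simp only [hslice x (Or.inl hx), zero_mul, mul_zero]
  set T := (∫ t in Ioi ε, ∫ x, timeDeriv φ x t * transportedData f u₀ v₀ x t) +
      (∫ t in Ioi ε, ∫ᵛ x, transportedData f u₀ v₀ x t ∂•(μ t)) +
      ∫ x, transportedData f u₀ v₀ x ε * φ (x, ε) with hT
  -- The three summands weigh a uniform error in the `φ_t` term, the flux term and the term at time
  -- `ε`.
  set M := K * (R - -R) * (R - 0) + C * (R - 0) + K * (R - -R)
  have hRR : 0 ≤ R - -R := by linarith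
  have hM : 0 ≤ M := add_nonneg (add_nonneg (mul_nonneg (mul_nonneg hK hRR) (by linarith))
    (mul_nonneg hC0 (by linarith))) (mul_nonneg hK hRR)
  have key : ∀ δ, 0 < δ → |T| ≤ δ * M := by
    intro δ hδ
    obtain ⟨S, hS, hSv⟩ := h.exists_staircase_approximation hv₀ hφ hμ hδ
    have hSε := hS ε hε
    have hge : ∀ t ∈ Ioi ε, t ∉ Icc 0 R → R ≤ t := fun t ht hn => by
      by_contra! hlt
      exact hn ⟨(hε.trans ht).le, hlt.le⟩
    have bA : |∫ t in Ioi ε, ((∫ x, timeDeriv φ x t * S x t) -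
        ∫ x, timeDeriv φ x t * transportedData f u₀ v₀ x t)| ≤ K * δ * (R - -R) * (R - 0) :=
      abs_setIntegral_le measurableSet_Ioi (mul_nonneg (by positivity) hRR) hR.le
        (fun t ht hn => by simp [hzero t _ (hge t ht hn)])
        fun t ht hm => h.abs_integral_timeDeriv_sub_le hv₀ hφ hε (le_of_lt ht) hm.2 hSε hδ.le hSv
    have bB : |∫ t in Ioi ε, ((∫ᵛ x, S x t ∂•(μ t)) -
        ∫ᵛ x, transportedData f u₀ v₀ x t ∂•(μ t))| ≤ δ * C * (R - 0) :=
      abs_setIntegral_le measurableSet_Ioi (by positivity) hR.le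
        (fun t ht hn => by simp [hμ.zero t (hge t ht hn)])
        fun t ht hm => h.abs_flux_sub_le hv₀ hφ hμ hε (le_of_lt ht) hm.2 hSε hδ.le hC hSv
    obtain ⟨CS, hCS⟩ := hSε.bdd
    have iS : Integrable fun x => S x ε * φ (x, ε) :=
      (integrable_mul_of_bounded (hφ.integrable_slice ε) (hSε.meas ε).aestronglyMeasurable
        (Eventually.of_forall fun x => hCS x ε le_rfl)).congr
        (Eventually.of_forall fun x => mul_comm _ _)
    have bC : |∫ x, (S x ε * φ (x, ε) - transportedData f u₀ v₀ x ε * φ (x, ε))| ≤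
        δ * K * (R - -R) := by
      rw [← setIntegral_univ]
      refine abs_setIntegral_le MeasurableSet.univ (by positivity) (by linarith)
        (fun x _ hx => by rw [hslice x (Or.inl hx)]; ring) fun x _ hx => ?_
      rcases lt_or_ge R ε with hRε | hRε
      · rw [hslice x (Or.inr hRε)]
        simp only [mul_zero, sub_zero, abs_zero]
        positivity
      · rw [← sub_mul, abs_mul]
        exact mul_le_mul (hSv x ε hx hε hRε) (hφ.bound _) (abs_nonneg _) hδ.le
    rw [integral_sub hSε.integrable_time iA] at bA
    rw [integral_sub hSε.integrable_flux iB] at bB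
    rw [integral_sub iS iC] at bC
    have e := hSε.eq_zero
    have a1 := abs_le.mp bA
    have a2 := abs_le.mp bB
    have a3 := abs_le.mp bC
    have e2 : δ * M = K * δ * (R - -R) * (R - 0) + δ * C * (R - 0) + δ * K * (R - -R) := by
      ring
    rw [e2, abs_le]
    constructor <;> linarith [a1.1, a1.2, a2.1, a2.2, a3.1, a3.2]
  by_contra hne
  have hTpos : 0 < |T| := abs_pos.mpr hne
  have h1 := key (|T| / (2 * (M + 1))) (by positivity)
  have h2 : |T| / (2 * (M + 1)) * M < |T| := by
    rw [div_mul_eq_mul_div, div_lt_iff₀ (by positivity)]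
    nlinarith
  linarith

/-- By `transport_identity` the flux integral over `(ε, ∞)` is minus the sum of two terms that
converge as `ε ↓ 0`, so absolute integrability of the flux near `t = 0` is not needed. -/
theorem isWeakTransportSolution (h : HopfLaxSetting f u₀) (hv₀ : Continuous v₀) :
    IsWeakTransportSolution (fun x t => deriv f (rhoPlus f u₀ x t)) v₀
      (transportedData f u₀ v₀) := by
  intro φ hφs hφc
  obtain ⟨R, K, hφ⟩ := exists_isTestFunction hφs hφc
  obtain ⟨μ, hμ⟩ := h.exists_isFluxMeasureFamily hφ
  refine ⟨μ, hμ.stieltjes, fun t ht => h.integrable_flux_slice hv₀ hφ hμ ht,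
    h.integrableOn_timeDeriv_mul hv₀ hφ, fun ε hε => h.integrableOn_flux hv₀ hφ hμ hε, ?_⟩
  have iA := h.integrableOn_integral_timeDeriv_mul hv₀ hφ
  have hε : Tendsto (fun ε : ℝ => ε) (𝓝[>] 0) (𝓝 0) := tendsto_id.mono_left nhdsWithin_le_nhds
  have limA : Tendsto
      (fun ε : ℝ => ∫ t in Ioi ε, ∫ x, timeDeriv φ x t * transportedData f u₀ v₀ x t) (𝓝[>] 0)
      (𝓝 (∫ t in Ioi 0, ∫ x, timeDeriv φ x t * transportedData f u₀ v₀ x t)) := by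
    have hcov : AECover (volume.restrict (Ioi (0 : ℝ))) (𝓝[>] 0) fun ε : ℝ => Ioi ε :=
      aecover_Ioi_of_Ioi hε
    refine (hcov.integral_tendsto_of_countably_generated iA).congr' ?_
    filter_upwards [self_mem_nhdsWithin] with ε hε0
    rw [Measure.restrict_restrict measurableSet_Ioi,
      inter_eq_self_of_subset_left (Ioi_subset_Ioi (le_of_lt hε0))]
  obtain ⟨C, hC0, hC⟩ := h.exists_transportedData_le hv₀ hφ.pos
  have limC : Tendsto (fun ε : ℝ => ∫ x, transportedData f u₀ v₀ x ε * φ (x, ε)) (𝓝[>] 0)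
      (𝓝 (∫ x, v₀ x * φ (x, 0))) := by
    refine tendsto_integral_filter_of_dominated_convergence
      ((Icc (-R) R).indicator fun _ => C * K) ?_ ?_ ?_ ?_
    · filter_upwards [self_mem_nhdsWithin] with ε hε0
      exact ((h.measurable_transportedData hv₀ hε0).mul
        (hφ.continuous.comp (by fun_prop)).measurable).aestronglyMeasurable
    · filter_upwards [self_mem_nhdsWithin,
        mem_nhdsWithin_of_mem_nhds (Iic_mem_nhds hφ.pos)] with ε hε0 hεR
      refine Eventually.of_forall fun x => ?_
      by_cases hx : x ∈ Icc (-R) R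
      · rw [indicator_of_mem hx, norm_mul]
        exact mul_le_mul (hC x ε hx hε0 hεR) (hφ.bound _) (norm_nonneg _) hC0
      · rw [indicator_of_notMem hx, hφ.zero x ε (Or.inl ?_), mul_zero, norm_zero]
        by_contra! hlt
        exact hx ⟨(abs_lt.mp hlt).1.le, (abs_lt.mp hlt).2.le⟩
    · exact (integrable_indicator_iff measurableSet_Icc).mpr
        (integrableOn_const measure_Icc_lt_top.ne)
    · refine Eventually.of_forall fun x => (h.tendsto_transportedData hv₀ x).mul ?_
      exact ((hφ.continuous.comp (f := fun ε : ℝ => (x, ε)) (by fun_prop)).tendsto 0).comp hε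
  have hlim := (limA.const_sub (∫ t in Ioi (0 : ℝ), ∫ x, timeDeriv φ x t *
    transportedData f u₀ v₀ x t)).add (limC.const_sub (∫ x, v₀ x * φ (x, 0)))
  rw [sub_self, sub_self, add_zero] at hlim
  refine hlim.congr' ?_
  filter_upwards [self_mem_nhdsWithin] with ε hε0
  linarith [h.transport_identity hv₀ hφ hμ hε0]

end HopfLaxSetting

theorem mainTheorem5
    (f : ℝ → ℝ)
    (hf_convex : StrictConvexOn ℝ univ f)
    (hf_diff : Differentiable ℝ f)
    (hf_speed : 0 ≤ deriv f 0)
    (hf_conj : ∀ z : ℝ, BddAbove (range fun ρ : ℝ => z * ρ - f ρ))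
    (u₀ : ℝ → ℝ)
    (hu_mono : Monotone u₀)
    (hu_left : ∀ x, ContinuousWithinAt u₀ (Iic x) x)
    (hu_growth : ∀ x t : ℝ, 0 < t → Tendsto (hopfLaxObjective f u₀ x t) atBot atTop)
    (v₀ : ℝ → ℝ)
    (hv₀ : Continuous v₀) :
    IsWeakTransportSolution (fun x t => deriv f (rhoPlus f u₀ x t)) v₀
      (transportedData f u₀ v₀) :=
  HopfLaxSetting.isWeakTransportSolution
    ⟨⟨hf_convex, hf_diff, hf_conj⟩, hf_speed, hu_mono, hu_left, hu_growth⟩ hv₀
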